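/- Let $H$ be a finite-dimensional complex Hilbert space, $O$ an operator on $H$, and $\rho$ a state on $H$ (a positive semidefinite operator with $\operatorname{Tr}\rho=1$). Write $\|A\|_r=(\operatorname{Tr}|A|^r)^{1/r}$ with $|A|=\sqrt{A^\dagger A}$ for the Schatten norms ($r>0$), $\|A\|_\infty$ for the operator norm, $\langle O\rangle_\rho=\operatorname{Tr}(\rho O)$, $\operatorname{supp}(\rho)=(\ker\rho)^\perp$, and let $D_B(\rho,\sigma)=\min_{u\ \mathrm{unitary}}\|\sqrt\rho-u\sqrt\sigma\|_2$ be the Bures metric. For $0<p,q\le 1$ put $$\mathcal C_{p,q}(O,\rho)=\bigl\|\rho^{p/2}\,O\,\rho^{q/2}\bigr\|_{2/(p+q)} .$$ Then, for all $p,q,p_0,q_0,p_1,q_1\in(0,1]$: 1. (Positivity) $\mathcal C_{p,q}(O,\rho)\ge 0$, and $\mathcal C_{p,q}(O,\rho)=0$ if and only if $O(\operatorname{supp}(\rho))\subseteq\operatorname{supp}(\rho)^\perp$. 2. (Monotonicity) $\mathcal C_{p,q}(O,\rho)$ is non-increasing in $p$ and non-increasing in $q$ on $(0,1]$. 3. (Range)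 $|\langle O\rangle_\rho|\le \mathcal C_{p,q}(O,\rho)\le\|O\|_\infty$. 4. (Symmetry) $\mathcal C_{p,q}(O,\rho)=\mathcal C_{q,p}(O^\dagger,\rho)$. 5. (Multiplicativity) For operators $O_A,O_B$ and states $\rho_A,\rho_B$ on finite-dimensional Hilbert spaces $H_A,H_B$, $\mathcal C_{p,q}(O_A\otimes O_B,\rho_A\otimes\rho_B)=\mathcal C_{p,q}(O_A,\rho_A)\,\mathcal C_{p,q}(O_B,\rho_B)$. 6. (Continuity) There is a universal constant $K>0$, independent of the space, the operator, the states and $p,q$, such that $|\mathcal C_{p,q}(O,\rho)-\mathcal C_{p,q}(O,\sigma)|\le K\,\|O\|_\infty\,D_B(\rho,\sigma)^{\min\{p,q\}}$ for all states $\rho,\sigma$ on $H$. 7. (Log-convexity) For all $\theta\in[0,1]$, $\mathcal C_{(1-\theta)p_0+\theta p_1,\,(1-\theta)q_0+\theta q_1}(O,\rho)\le \mathcal C_{p_0,q_0}(O,\rho)^{1-\theta}\,\mathcal C_{p_1,q_1}(O,\rho)^{\theta}$ (with $0^0=1$); equivalently, when $\mathcal C_{p,q}(O,\rho)$ does not vanish,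 $\log\mathcal C_{p,q}(O,\rho)$ is jointly convex in $(p,q)\in(0,1]^2$. -/

import Mathlib

open scoped TensorProduct

/-- Finite-dimensional complex inner product spaces are complete, hence Hilbert spaces. -/
instance instCompleteSpaceOfFiniteDimensionalComplex {H : Type*} [NormedAddCommGroup H]
    [InnerProductSpace ℂ H] [FiniteDimensional ℂ H] : CompleteSpace H :=
  FiniteDimensional.complete ℂ H

namespace NonlinearCorrelator

noncomputable section

/-- The trace of an operator on a finite-dimensional Hilbert space. -/
def opTrace {H : Type*} [NormedAddCommGroup H] [InnerProductSpace ℂ H]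
    (A : H →L[ℂ] H) : ℂ :=
  LinearMap.trace ℂ H (A : H →ₗ[ℂ] H)

/-- A (mixed) state: a positive semidefinite operator of trace one. -/
def IsState {H : Type*} [NormedAddCommGroup H] [InnerProductSpace ℂ H]
    (ρ : H →L[ℂ] H) : Prop :=
  ρ.IsPositive ∧ opTrace ρ = 1

/-- The Schatten norm `‖A‖_r = (Tr |A|^r)^(1/r)` for `r > 0`, where `|A| = √(A† A)`.
(The trace is a nonnegative real number, so taking its real part loses nothing.) -/
def schattenNorm {H : Type*} [NormedAddCommGroup H] [InnerProductSpace ℂ H]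
    [FiniteDimensional ℂ H] (r : ℝ) (A : H →L[ℂ] H) : ℝ :=
  (opTrace (CFC.abs A ^ r)).re ^ (1 / r)

/-- The correlator `C_{p,q}(O, ρ) = ‖ρ^(p/2) O ρ^(q/2)‖_{2/(p+q)}`. -/
def correlator {H : Type*} [NormedAddCommGroup H] [InnerProductSpace ℂ H]
    [FiniteDimensional ℂ H] (p q : ℝ) (O ρ : H →L[ℂ] H) : ℝ :=
  schattenNorm (2 / (p + q)) (ρ ^ (p / 2) * O * ρ ^ (q / 2))

/-- The support of a positive operator: the orthogonal complement of its kernel. -/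
def supp {H : Type*} [NormedAddCommGroup H] [InnerProductSpace ℂ H]
    (ρ : H →L[ℂ] H) : Submodule ℂ H :=
  (LinearMap.ker (ρ : H →ₗ[ℂ] H))ᗮ

/-- The Bures metric `D_B(ρ, σ) = min_u ‖√ρ - u √σ‖₂` over all unitaries `u`
(the infimum is over a nonempty compact set and is attained). -/
def buresDist {H : Type*} [NormedAddCommGroup H] [InnerProductSpace ℂ H]
    [FiniteDimensional ℂ H] (ρ σ : H →L[ℂ] H) : ℝ :=
  ⨅ u : unitary (H →L[ℂ] H),
    schattenNorm 2 (CFC.sqrt ρ - (u : H →L[ℂ] H) * CFC.sqrt σ)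

/-- The tensor product of two operators, acting on the tensor product Hilbert space. -/
def opTensor {H₁ H₂ : Type*} [NormedAddCommGroup H₁] [InnerProductSpace ℂ H₁]
    [FiniteDimensional ℂ H₁] [NormedAddCommGroup H₂] [InnerProductSpace ℂ H₂]
    [FiniteDimensional ℂ H₂] (A : H₁ →L[ℂ] H₁) (B : H₂ →L[ℂ] H₂) :
    (H₁ ⊗[ℂ] H₂) →L[ℂ] (H₁ ⊗[ℂ] H₂) :=
  LinearMap.toContinuousLinearMap
    (TensorProduct.map (A : H₁ →ₗ[ℂ] H₁) (B : H₂ →ₗ[ℂ] H₂))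

end

end NonlinearCorrelator

set_option linter.unusedSectionVars false

namespace NonlinearCorrelator

noncomputable section

/-! ### Complex powers of positive operators. -/

section SpectralPower

open scoped ComplexOrder

variable {H : Type*} [NormedAddCommGroup H] [InnerProductSpace ℂ H] [FiniteDimensional ℂ H]

/-! The estimates rest on Hölder inequalities for traces, obtained from Hadamard's three lines
theorem. In finite dimension `z ↦ A ^ z` (with `0 ^ z = 0`) is entire, and imaginary powers are
contractions. A trace of powers of two or three states whose exponents have real parts summing to 1,
interleaved with operators X, Y, ..., is bounded by ‖X‖‖Y‖⋯: moving the exponents across the strip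
reduces this to |Tr(ρ X)| ≤ ‖X‖ for one state.

A nonzero T equals ‖T‖_r W τ^(1/r), with W a contraction and τ = |T|^r / Tr |T|^r a state
(`exists_schatten_polar`). For r ≥ 1 this yields the duality ‖T‖_r = max |Tr(U T τ^(1-1/r))| over
contractions U and states τ (`norm_opTrace_le_schattenNorm`, `exists_opTrace_eq_schattenNorm`). It
applies to the correlator because p, q ≤ 1 makes 2/(p+q) ≥ 1. Monotonicity, the range, symmetry and
log-convexity follow. The vanishing criterion holds because ρ^(p/2) is invertible on the support of
ρ, and multiplicativity because |·| and powers respect tensor products.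

For continuity, unitary invariance allows ρ^(p/2) O ρ^(q/2) to be compared with u σ^(p/2) O σ^(q/2)
u*. Telescoping and Hölder leave ‖ρ^(θ/2) - u σ^(θ/2)‖_{2/θ} for θ = p, q, which is at most 9 ‖√ρ -
u√σ‖₂^θ (`schattenNorm_spow_sub_le`). This is again three lines: the edge Re z = 0 is trivial, and
Re z = 1 is a Hilbert–Schmidt estimate checked entry by entry in eigenbases of ρ and σ
(`schattenNorm_two_spow_sub_le`). -/

lemma finite_spectrum (A : H →L[ℂ] H) : (spectrum ℂ A).Finite := by
  have h := Module.End.finite_spectrum (K := ℂ) (V := H) (A : H →ₗ[ℂ] H)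
  refine h.subset fun z hz => ?_
  have := AlgEquiv.spectrum_eq (Module.End.toContinuousLinearMap (𝕜 := ℂ) H).symm A
  rwa [← this] at hz

lemma continuousOn_spectrum (A : H →L[ℂ] H) (f : ℂ → ℂ) : ContinuousOn f (spectrum ℂ A) :=
  (finite_spectrum A).continuousOn f

/-- The function `x ↦ x ^ z` with the value `0` at `x = 0` for every exponent. -/
def powFun (z x : ℂ) : ℂ := if x = 0 then 0 else x ^ z

/-- The complex power `A ^ z` of a positive operator, supported on the support of `A`:
`A ^ 0` is the support projection. -/
def spow (A : H →L[ℂ] H) (z : ℂ) : H →L[ℂ] H := cfc (powFun z) A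

lemma powFun_add (z w x : ℂ) : powFun (z + w) x = powFun z x * powFun w x := by
  by_cases h : x = 0
  · simp [powFun, h]
  · simp [powFun, h, Complex.cpow_add]

lemma spow_add (A : H →L[ℂ] H) (z w : ℂ) : spow A (z + w) = spow A z * spow A w := by
  rw [spow, spow, spow, ← cfc_mul _ _ A (continuousOn_spectrum _ _) (continuousOn_spectrum _ _)]
  exact congrArg (cfc · A) (funext fun x => powFun_add z w x)

lemma powFun_one : powFun 1 = id := by
  ext x; by_cases h : x = 0 <;> simp [powFun, h]

lemma spow_one {A : H →L[ℂ] H} (hA : 0 ≤ A) : spow A 1 = A := by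
  rw [spow, powFun_one]
  exact cfc_id ℂ A (IsSelfAdjoint.of_nonneg hA).isStarNormal

lemma spectrum_real {A : H →L[ℂ] H} (hA : 0 ≤ A) {x : ℂ} (hx : x ∈ spectrum ℂ A) :
    0 ≤ x.re ∧ (x.re : ℂ) = x := by
  have h := spectrum_nonneg_of_nonneg hA hx
  rw [Complex.nonneg_iff] at h
  exact ⟨h.1, Complex.ext rfl (by simpa using h.2)⟩

lemma powFun_ofReal {x : ℝ} (hx : 0 ≤ x) {r : ℝ} (hr : 0 < r) :
    powFun r x = ((x ^ r : ℝ) : ℂ) := by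
  rcases hx.eq_or_lt with rfl | hx'
  · simp [powFun, Real.zero_rpow hr.ne']
  · simp [powFun, hx'.ne', Complex.ofReal_cpow hx]

/-- The exponent must be positive: at exponent 0 the left side is the identity, the right side the
support projection. -/
lemma rpow_eq_spow {A : H →L[ℂ] H} (hA : 0 ≤ A) {r : ℝ} (hr : 0 < r) : A ^ r = spow A r := by
  rw [CFC.rpow_eq_cfc_real, cfc_real_eq_complex, spow]
  refine cfc_congr fun x hx => ?_
  obtain ⟨h0, h1⟩ := spectrum_real hA hx
  rw [← h1, powFun_ofReal h0 hr]
  simp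

lemma spow_nonneg {A : H →L[ℂ] H} (hA : 0 ≤ A) (r : ℝ) : 0 ≤ spow A r := by
  refine cfc_nonneg fun x hx => ?_
  obtain ⟨h0, h1⟩ := spectrum_real hA hx
  rw [← h1]
  rcases h0.eq_or_lt with h | h
  · simp [powFun, ← h]
  · simp only [powFun, Complex.ofReal_eq_zero, h.ne', if_false]
    rw [← Complex.ofReal_cpow h0]
    exact_mod_cast Real.rpow_nonneg h0 r

lemma spow_spow {A : H →L[ℂ] H} (hA : 0 ≤ A) {r : ℝ} (z : ℂ) :
    spow (spow A r) z = spow A (r * z) := by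
  have hn := (IsSelfAdjoint.of_nonneg hA).isStarNormal
  rw [spow, spow, spow, ← cfc_comp (powFun z) (powFun r) A hn
    (((finite_spectrum A).image _).continuousOn _) (continuousOn_spectrum _ _)]
  refine cfc_congr fun x hx => ?_
  obtain ⟨h0, h1⟩ := spectrum_real hA hx
  rw [← h1]
  rcases h0.eq_or_lt with h | h
  · simp [powFun, ← h]
  · simp only [powFun, Function.comp, Complex.ofReal_eq_zero, h.ne', if_false]
    rw [← Complex.ofReal_cpow h0, if_neg (by exact_mod_cast (Real.rpow_pos_of_pos h r).ne'),
      Complex.ofReal_cpow h0, ← Complex.cpow_mul]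
    · rw [← Complex.ofReal_log h0, ← Complex.ofReal_mul, Complex.ofReal_im]
      exact neg_lt_zero.mpr Real.pi_pos
    · rw [← Complex.ofReal_log h0, ← Complex.ofReal_mul, Complex.ofReal_im]
      exact Real.pi_pos.le

lemma spow_smul {A : H →L[ℂ] H} (hA : 0 ≤ A) {c : ℝ} (hc : 0 < c) (z : ℂ) :
    spow ((c : ℂ) • A) z = (c : ℂ) ^ z • spow A z := by
  have hn := (IsSelfAdjoint.of_nonneg hA).isStarNormal
  rw [spow, spow, ← cfc_smul _ _ A (continuousOn_spectrum _ _),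
    ← cfc_comp_smul (c : ℂ) (powFun z) A (((finite_spectrum A).image _).continuousOn _)]
  refine cfc_congr fun x hx => ?_
  obtain ⟨h0, h1⟩ := spectrum_real hA hx
  rw [← h1]
  rcases h0.eq_or_lt with h | h
  · simp [powFun, ← h]
  · simp [powFun, h.ne', hc.ne', Complex.mul_cpow_ofReal_nonneg hc.le h0]

lemma norm_spow_le_one {A : H →L[ℂ] H} (hA : 0 ≤ A) (hA1 : ‖A‖ ≤ 1) {z : ℂ} (hz : 0 ≤ z.re) :
    ‖spow A z‖ ≤ 1 := by
  refine norm_cfc_le zero_le_one fun x hx => ?_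
  obtain ⟨h0, h1⟩ := spectrum_real hA hx
  have hx1 : x.re ≤ 1 := by
    have : Nontrivial (H →L[ℂ] H) := by
      by_contra h
      rw [not_nontrivial_iff_subsingleton] at h
      simp [spectrum.of_subsingleton] at hx
    have := spectrum.norm_le_norm_of_mem hx
    rw [← h1, Complex.norm_real, Real.norm_of_nonneg h0] at this
    exact this.trans hA1
  rw [← h1]
  rcases h0.eq_or_lt with h | h
  · simp [powFun, ← h]
  · simp only [powFun, Complex.ofReal_eq_zero, h.ne', if_false]
    rw [Complex.norm_cpow_eq_rpow_re_of_pos h]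
    exact Real.rpow_le_one h0 hx1 hz

lemma norm_spow_zero_le_one (A : H →L[ℂ] H) : ‖spow A 0‖ ≤ 1 := by
  refine norm_cfc_le zero_le_one fun x _ => ?_
  by_cases h : x = 0 <;> simp [powFun, h]

lemma star_spow {A : H →L[ℂ] H} (hA : 0 ≤ A) (r : ℝ) : star (spow A r) = spow A r :=
  (IsSelfAdjoint.of_nonneg (spow_nonneg hA r)).star_eq

/-- The spectrum is finite, so A^z is a finite sum of scalars l^z times fixed spectral projections.
-/
lemma differentiable_spow (A : H →L[ℂ] H) : Differentiable ℂ (spow A) := by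
  classical
  have key : spow A = fun z => ∑ l ∈ (finite_spectrum A).toFinset,
      powFun z l • cfc (fun x => if x = l then (1 : ℂ) else 0) A := by
    funext z
    simp_rw [← cfc_smul _ _ A (continuousOn_spectrum _ _)]
    rw [← cfc_sum _ _ _ (fun i _ => continuousOn_spectrum _ _)]
    refine cfc_congr fun x hx => ?_
    simp [Finset.sum_apply, hx]
  rw [key]
  refine Differentiable.fun_sum fun l _ => Differentiable.smul_const ?_ _
  by_cases h : l = 0
  · simp [powFun, h]
  · simp only [powFun, h, if_false]
    exact fun z => (differentiableAt_id.const_cpow (Or.inl h))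

lemma cfc_apply_of_eigenvector {A : H →L[ℂ] H} (hA : IsStarNormal A) (f : ℂ → ℂ) {l : ℂ} {v : H}
    (hv : A v = l • v) : cfc f A v = f l • v := by
  -- Divide f - f(l) by x - l on the spectrum; the quotient takes the value 0 at x = l since `0⁻¹ =
  -- 0`. The factor A - l then kills the eigenvector.
  have key : cfc f A = f l • 1 + cfc (fun x => (f x - f l) * (x - l)⁻¹) A * (A - l • 1) := by
    have h2 : A - l • 1 = cfc (fun x => x - l) A := by
      rw [cfc_sub _ _ A (continuousOn_spectrum _ _) (continuousOn_spectrum _ _), cfc_id' ℂ A,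
        cfc_const l A, Algebra.algebraMap_eq_smul_one]
    rw [h2, ← cfc_mul _ _ A (continuousOn_spectrum _ _) (continuousOn_spectrum _ _),
      ← Algebra.algebraMap_eq_smul_one, ← cfc_const_add _ _ A (continuousOn_spectrum _ _)]
    refine cfc_congr fun x _ => ?_
    by_cases h : x = l
    · simp [h]
    · have : x - l ≠ 0 := sub_ne_zero.mpr h
      simp [this]
  rw [key]
  simp [hv]

lemma spow_apply_of_eigenvector {A : H →L[ℂ] H} (hA : 0 ≤ A) (z : ℂ) {l : ℂ} {v : H}
    (hv : A v = l • v) : spow A z v = powFun z l • v :=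
  cfc_apply_of_eigenvector (IsSelfAdjoint.of_nonneg hA).isStarNormal _ hv

lemma spow_zero_mul_spow (A : H →L[ℂ] H) (z : ℂ) : spow A 0 * spow A z = spow A z := by
  rw [← spow_add, zero_add]

lemma spow_mul_spow_zero (A : H →L[ℂ] H) (z : ℂ) : spow A z * spow A 0 = spow A z := by
  rw [← spow_add, add_zero]

lemma spow_zero_mul {A : H →L[ℂ] H} (hA : 0 ≤ A) : spow A 0 * A = A := by
  simpa only [spow_one hA] using spow_zero_mul_spow A 1

lemma mul_spow_zero {A : H →L[ℂ] H} (hA : 0 ≤ A) : A * spow A 0 = A := by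
  simpa only [spow_one hA] using spow_mul_spow_zero A 1

end SpectralPower

/-! ### Hölder inequalities for traces of powers of states. -/

section TraceHoelder

variable {H : Type*} [NormedAddCommGroup H] [InnerProductSpace ℂ H] [FiniteDimensional ℂ H]

lemma opTrace_mul_comm (A B : H →L[ℂ] H) : opTrace (A * B) = opTrace (B * A) :=
  LinearMap.trace_mul_comm ℂ (A : H →ₗ[ℂ] H) (B : H →ₗ[ℂ] H)

lemma opTrace_add (A B : H →L[ℂ] H) : opTrace (A + B) = opTrace A + opTrace B := by
  simp [opTrace]

lemma opTrace_smul (c : ℂ) (A : H →L[ℂ] H) : opTrace (c • A) = c * opTrace A := by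
  simp [opTrace]

lemma opTrace_zero : opTrace (0 : H →L[ℂ] H) = 0 := by
  simp [opTrace]

lemma opTrace_eq_sum_inner {ι : Type*} [Fintype ι] (b : OrthonormalBasis ι ℂ H)
    (A : H →L[ℂ] H) : opTrace A = ∑ i, inner ℂ (b i) (A (b i)) :=
  LinearMap.trace_eq_sum_inner (A : H →ₗ[ℂ] H) b

/-- The trace as a continuous linear functional. -/
def traceCLM : (H →L[ℂ] H) →L[ℂ] ℂ :=
  ∑ i, (innerSL ℂ (stdOrthonormalBasis ℂ H i)).comp
    (ContinuousLinearMap.apply ℂ H (stdOrthonormalBasis ℂ H i))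

lemma traceCLM_apply (A : H →L[ℂ] H) : traceCLM A = opTrace A := by
  simp [traceCLM, opTrace_eq_sum_inner (stdOrthonormalBasis ℂ H)]

lemma exists_eigenbasis {A : H →L[ℂ] H} (hA : 0 ≤ A) :
    ∃ (b : OrthonormalBasis (Fin (Module.finrank ℂ H)) ℂ H) (l : Fin (Module.finrank ℂ H) → ℝ),
      (∀ i, 0 ≤ l i) ∧ ∀ i, A (b i) = (l i : ℂ) • b i := by
  have hp := (ContinuousLinearMap.nonneg_iff_isPositive A).mp hA
  have hs : (A : H →ₗ[ℂ] H).IsSymmetric := hp.isSymmetric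
  refine ⟨hs.eigenvectorBasis rfl, hs.eigenvalues rfl, fun i => ?_, fun i =>
    hs.apply_eigenvectorBasis rfl i⟩
  exact LinearMap.IsPositive.nonneg_eigenvalues hp.toLinearMap rfl i

lemma inner_apply_eq_of_nonneg {A : H →L[ℂ] H} (hA : 0 ≤ A) (x y : H) :
    inner ℂ (A x) y = inner ℂ x (A y) :=
  ((ContinuousLinearMap.nonneg_iff_isPositive A).mp hA).isSymmetric x y

lemma opTrace_eq_sum_eigenvalues {A : H →L[ℂ] H} {ι : Type*} [Fintype ι]
    (b : OrthonormalBasis ι ℂ H) {l : ι → ℂ} (h : ∀ i, A (b i) = l i • b i) :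
    opTrace A = ∑ i, l i := by
  rw [opTrace_eq_sum_inner b]
  exact Finset.sum_congr rfl fun i _ => by simp [h]

lemma IsState.nonneg {ρ : H →L[ℂ] H} (h : IsState ρ) : 0 ≤ ρ :=
  (ContinuousLinearMap.nonneg_iff_isPositive ρ).mpr h.1

lemma IsState.norm_opTrace_mul_le {ρ : H →L[ℂ] H} (h : IsState ρ) (X : H →L[ℂ] H) :
    ‖opTrace (ρ * X)‖ ≤ ‖X‖ := by
  obtain ⟨b, l, hl, hb⟩ := exists_eigenbasis h.nonneg
  have h1 : ∑ i, l i = 1 := by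
    have := h.2
    rw [opTrace_eq_sum_eigenvalues b hb] at this
    exact_mod_cast this
  rw [opTrace_mul_comm, opTrace_eq_sum_inner b]
  calc ‖∑ i, inner ℂ (b i) ((X * ρ) (b i))‖
      ≤ ∑ i, ‖inner ℂ (b i) ((X * ρ) (b i))‖ := norm_sum_le _ _
    _ ≤ ∑ i, l i * ‖X‖ := by
        refine Finset.sum_le_sum fun i _ => ?_
        rw [mul_apply_eq_comp, hb, map_smul, inner_smul_right, norm_mul,
          Complex.norm_real, Real.norm_of_nonneg (hl i)]
        refine mul_le_mul_of_nonneg_left ?_ (hl i)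
        refine (norm_inner_le_norm _ _).trans ?_
        have := X.le_opNorm (b i)
        simpa using this
    _ = ‖X‖ := by rw [← Finset.sum_mul, h1, one_mul]

lemma IsState.norm_le_one {ρ : H →L[ℂ] H} (h : IsState ρ) : ‖ρ‖ ≤ 1 := by
  obtain ⟨b, l, hl, hb⟩ := exists_eigenbasis h.nonneg
  have h1 : ∑ i, l i = 1 := by
    have := h.2
    rw [opTrace_eq_sum_eigenvalues b hb] at this
    exact_mod_cast this
  refine ContinuousLinearMap.opNorm_le_bound _ zero_le_one fun x => ?_
  rw [one_mul]
  refine (sq_le_sq₀ (norm_nonneg _) (norm_nonneg _)).mp ?_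
  rw [← b.sum_sq_norm_inner_right, ← b.sum_sq_norm_inner_right x]
  refine Finset.sum_le_sum fun i _ => ?_
  rw [← inner_apply_eq_of_nonneg h.nonneg, hb, inner_smul_left, norm_mul]
  have hli : l i ≤ 1 := h1 ▸ Finset.single_le_sum (fun j _ => hl j) (Finset.mem_univ i)
  have : ‖(starRingEnd ℂ) (l i : ℂ)‖ ≤ 1 := by simpa [abs_of_nonneg (hl i)] using hli
  gcongr
  exact mul_le_of_le_one_left (norm_nonneg _) this

lemma IsState.norm_spow_le_one {ρ : H →L[ℂ] H} (h : IsState ρ) {z : ℂ} (hz : 0 ≤ z.re) :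
    ‖spow ρ z‖ ≤ 1 :=
  NonlinearCorrelator.norm_spow_le_one h.nonneg h.norm_le_one hz

/-- Hadamard's three lines theorem for the trace of an entire operator family. -/
lemma norm_opTrace_le_of_strip {F : ℂ → H →L[ℂ] H} (hF : Differentiable ℂ F) {C a b : ℝ}
    (hC : ∀ z : ℂ, 0 ≤ z.re → z.re ≤ 1 → ‖F z‖ ≤ C)
    (ha : ∀ z : ℂ, z.re = 0 → ‖opTrace (F z)‖ ≤ a)
    (hb : ∀ z : ℂ, z.re = 1 → ‖opTrace (F z)‖ ≤ b) {t : ℝ} (h0 : 0 ≤ t) (h1 : t ≤ 1) :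
    ‖opTrace (F t)‖ ≤ a ^ (1 - t) * b ^ t := by
  have hd : Differentiable ℂ fun z => opTrace (F z) := by
    simp_rw [← traceCLM_apply]
    exact traceCLM.differentiable.comp hF
  have := Complex.HadamardThreeLines.norm_le_interp_of_mem_verticalClosedStrip₀₁'
    (fun z => opTrace (F z)) (z := (t : ℂ)) (a := a) (b := b)
    (by simp [Complex.HadamardThreeLines.verticalClosedStrip, h0, h1]) hd.diffContOnCl ?_
    (fun z hz => ha z hz) (fun z hz => hb z hz)
  · simpa using this
  · refine ⟨‖(traceCLM : (H →L[ℂ] H) →L[ℂ] ℂ)‖ * C, ?_⟩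
    rintro _ ⟨z, hz, rfl⟩
    simp only [Function.comp, ← traceCLM_apply]
    exact (traceCLM.le_opNorm _).trans
      (mul_le_mul_of_nonneg_left (hC z hz.1 hz.2) (norm_nonneg _))

lemma norm_opTrace_le_of_strip_const {F : ℂ → H →L[ℂ] H} (hF : Differentiable ℂ F) {C a : ℝ}
    (hC : ∀ z : ℂ, 0 ≤ z.re → z.re ≤ 1 → ‖F z‖ ≤ C)
    (ha : ∀ z : ℂ, z.re = 0 → ‖opTrace (F z)‖ ≤ a)
    (hb : ∀ z : ℂ, z.re = 1 → ‖opTrace (F z)‖ ≤ a) {t : ℝ} (h0 : 0 ≤ t) (h1 : t ≤ 1) :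
    ‖opTrace (F t)‖ ≤ a := by
  have := norm_opTrace_le_of_strip hF hC ha hb h0 h1
  have ha0 : 0 ≤ a := (norm_nonneg _).trans (ha 0 rfl)
  rwa [← Real.rpow_add' ha0 (by simp), sub_add_cancel, Real.rpow_one] at this

/-- Split off one factor ρ; what remains of the power is imaginary, hence a contraction. -/
lemma IsState.norm_opTrace_spow_mul_le {ρ : H →L[ℂ] H} (h : IsState ρ) {z : ℂ} (hz : z.re = 1)
    (X : H →L[ℂ] H) : ‖opTrace (spow ρ z * X)‖ ≤ ‖X‖ := by
  have : spow ρ z * X = ρ * (spow ρ (z - 1) * X) := by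
    conv_rhs => enter [1]; rw [← spow_one h.nonneg]
    rw [← mul_assoc, ← spow_add]
    congr 2; ring
  rw [this]
  refine (h.norm_opTrace_mul_le _).trans ((norm_mul_le _ _).trans ?_)
  exact mul_le_of_le_one_left (norm_nonneg _) (h.norm_spow_le_one (by simp [hz]))

lemma norm_mul₄_le {a b c d : H →L[ℂ] H} {s t : ℝ} (ha : ‖a‖ ≤ 1) (hb : ‖b‖ ≤ s) (hc : ‖c‖ ≤ 1)
    (hd : ‖d‖ ≤ t) : ‖a * b * c * d‖ ≤ s * t := by
  have hs := (norm_nonneg _).trans hb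
  have h1 : ‖a * b‖ ≤ 1 * s := norm_mul_le_of_le ha hb
  have h2 : ‖a * b * c‖ ≤ 1 * s * 1 := norm_mul_le_of_le h1 hc
  simpa using norm_mul_le_of_le h2 hd

/-- The real parts of the exponents move across the strip with sum 1. At each edge one power has
real part 1, giving the one-state bound, and the other is a contraction. -/
lemma norm_opTrace_spow_mul₂_le {ρ τ : H →L[ℂ] H} (hρ : IsState ρ) (hτ : IsState τ)
    (X Y : H →L[ℂ] H) {z w : ℂ} (hz : 0 ≤ z.re) (hw : 0 ≤ w.re) (hzw : z.re + w.re = 1) :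
    ‖opTrace (spow ρ z * X * spow τ w * Y)‖ ≤ ‖X‖ * ‖Y‖ := by
  have hd : Differentiable ℂ fun s : ℂ =>
      spow ρ (s + z.im * Complex.I) * X * spow τ (1 - s + w.im * Complex.I) * Y := by
    have h1 := differentiable_spow ρ
    have h2 := differentiable_spow τ
    exact ((((h1.comp (by fun_prop)).mul_const X).mul (h2.comp (by fun_prop))).mul_const Y)
  have := norm_opTrace_le_of_strip_const hd (C := ‖X‖ * ‖Y‖) (a := ‖X‖ * ‖Y‖) (t := z.re)
    ?_ ?_ ?_ hz (by linarith)
  · have e1 : ((z.re : ℂ) + z.im * Complex.I) = z := Complex.re_add_im z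
    have e2 : (1 - (z.re : ℂ) + w.im * Complex.I) = w := by
      rw [show (1 : ℂ) = ((z.re + w.re : ℝ) : ℂ) by simp [hzw]]
      push_cast
      rw [add_sub_cancel_left, Complex.re_add_im]
    rwa [e1, e2] at this
  · intro s h0 h1
    exact norm_mul₄_le (hρ.norm_spow_le_one (by simp [h0])) le_rfl
      (hτ.norm_spow_le_one (by simp [h1])) le_rfl
  · intro s h0
    rw [mul_assoc, opTrace_mul_comm, mul_assoc]
    refine (hτ.norm_opTrace_spow_mul_le (by simp [h0]) _).trans ?_
    rw [← mul_assoc, mul_comm ‖X‖]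
    refine norm_mul_le_of_le ?_ le_rfl
    simpa using norm_mul_le_of_le (le_refl ‖Y‖) (hρ.norm_spow_le_one
      (z := s + z.im * Complex.I) (by simp [h0]))
  · intro s h1
    rw [mul_assoc, mul_assoc]
    refine (hρ.norm_opTrace_spow_mul_le (by simp [h1]) _).trans ?_
    refine norm_mul_le_of_le le_rfl ?_
    simpa using norm_mul_le_of_le (hτ.norm_spow_le_one
      (z := 1 - s + w.im * Complex.I) (by simp [h1])) (le_refl ‖Y‖)

/-- The exponent s of ρ moves across the strip while σ and τ share the remainder 1 - s in the ratio
b : c. On Re s = 0 a cyclic shift gives the two-state bound; on Re s = 1 the one-state bound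
applies. -/
lemma norm_opTrace_spow_mul₃_le {ρ σ τ : H →L[ℂ] H} (hρ : IsState ρ) (hσ : IsState σ)
    (hτ : IsState τ) (X Y Z : H →L[ℂ] H) {a b c : ℝ} (ha : 0 ≤ a) (hb : 0 ≤ b) (hc : 0 ≤ c)
    (habc : a + b + c = 1) :
    ‖opTrace (spow ρ a * X * spow σ b * Y * spow τ c * Z)‖ ≤ ‖X‖ * ‖Y‖ * ‖Z‖ := by
  have hbd : ∀ {A B C : H →L[ℂ] H}, ‖A‖ ≤ 1 → ‖B‖ ≤ 1 → ‖C‖ ≤ 1 →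
      ‖A * X * B * Y * C * Z‖ ≤ ‖X‖ * ‖Y‖ * ‖Z‖ := by
    intro A B C hA hB hC
    have h1 := norm_mul₄_le hA le_rfl hB le_rfl (b := X) (d := Y)
    have h2 := norm_mul_le_of_le (norm_mul_le_of_le h1 hC) (le_refl ‖Z‖)
    simpa using h2
  -- At a = 1 the shares b/(1-a) and c/(1-a) make no sense, but then b = c = 0 and one state
  -- suffices.
  rcases (show a ≤ 1 by linarith).eq_or_lt with rfl | ha1
  · have h0 : b = 0 := by linarith
    have h0' : c = 0 := by linarith
    subst h0 h0'
    have := hρ.norm_opTrace_spow_mul_le (z := (1 : ℝ)) (by simp)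
      (X * spow σ (0 : ℝ) * Y * spow τ (0 : ℝ) * Z)
    simp only [← mul_assoc] at this
    refine this.trans ?_
    have := hbd (A := 1) ContinuousLinearMap.norm_id_le
      (hσ.norm_spow_le_one (z := (0 : ℝ)) (by simp))
      (hτ.norm_spow_le_one (z := (0 : ℝ)) (by simp))
    simpa using this
  have h1a : (0 : ℝ) < 1 - a := by linarith
  have hd : Differentiable ℂ fun s : ℂ =>
      spow ρ s * X * spow σ ((1 - s) * (b / (1 - a) : ℝ)) * Y *
        spow τ ((1 - s) * (c / (1 - a) : ℝ)) * Z := by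
    have h1 := differentiable_spow ρ
    have h2 := differentiable_spow σ
    have h3 := differentiable_spow τ
    exact (((((h1.mul_const X).mul (h2.comp (by fun_prop))).mul_const Y).mul
      (h3.comp (by fun_prop))).mul_const Z)
  have hb' : 0 ≤ b / (1 - a) := by positivity
  have hc' : 0 ≤ c / (1 - a) := by positivity
  have hbc : b / (1 - a) + c / (1 - a) = 1 := by
    rw [← add_div, div_eq_one_iff_eq h1a.ne']; linarith
  have hσs : ∀ s : ℂ, s.re ≤ 1 → ‖spow σ ((1 - s) * (b / (1 - a) : ℝ))‖ ≤ 1 := fun s h =>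
    hσ.norm_spow_le_one (by
      rw [Complex.re_mul_ofReal]; simp only [Complex.sub_re, Complex.one_re]
      exact mul_nonneg (by linarith) hb')
  have hτs : ∀ s : ℂ, s.re ≤ 1 → ‖spow τ ((1 - s) * (c / (1 - a) : ℝ))‖ ≤ 1 := fun s h =>
    hτ.norm_spow_le_one (by
      rw [Complex.re_mul_ofReal]; simp only [Complex.sub_re, Complex.one_re]
      exact mul_nonneg (by linarith) hc')
  have := norm_opTrace_le_of_strip_const hd (C := ‖X‖ * ‖Y‖ * ‖Z‖) (a := ‖X‖ * ‖Y‖ * ‖Z‖) (t := a)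
    ?_ ?_ ?_ ha ha1.le
  · have e1 : (1 - (a : ℂ)) * (b / (1 - a) : ℝ) = b := by
      rw [← Complex.ofReal_one, ← Complex.ofReal_sub, ← Complex.ofReal_mul,
        mul_div_cancel₀ _ h1a.ne']
    have e2 : (1 - (a : ℂ)) * (c / (1 - a) : ℝ) = c := by
      rw [← Complex.ofReal_one, ← Complex.ofReal_sub, ← Complex.ofReal_mul,
        mul_div_cancel₀ _ h1a.ne']
    rwa [e1, e2] at this
  · intro s h0 h1
    exact hbd (hρ.norm_spow_le_one h0) (hσs s h1) (hτs s h1)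
  · intro s h0
    have := norm_opTrace_spow_mul₂_le hσ hτ Y (Z * (spow ρ s * X))
      (z := (1 - s) * (b / (1 - a) : ℝ)) (w := (1 - s) * (c / (1 - a) : ℝ))
      (by simp only [Complex.re_mul_ofReal]; simp [h0, hb'])
      (by simp only [Complex.re_mul_ofReal]; simp [h0, hc'])
      (by simp only [Complex.re_mul_ofReal]; simp [h0, hbc])
    rw [← mul_assoc _ Z, opTrace_mul_comm] at this
    simp only [← mul_assoc] at this
    refine this.trans ?_
    have h3 : ‖Z * spow ρ s * X‖ ≤ ‖Z‖ * 1 * ‖X‖ :=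
      norm_mul_le_of_le (norm_mul_le_of_le le_rfl (hρ.norm_spow_le_one h0.ge)) le_rfl
    calc _ ≤ ‖Y‖ * (‖Z‖ * 1 * ‖X‖) := by gcongr
      _ = _ := by ring
  · intro s h1
    have := hρ.norm_opTrace_spow_mul_le h1 (X * spow σ ((1 - s) * (b / (1 - a) : ℝ)) * Y *
      spow τ ((1 - s) * (c / (1 - a) : ℝ)) * Z)
    simp only [← mul_assoc] at this
    refine this.trans ?_
    have := hbd (A := 1) ContinuousLinearMap.norm_id_le (hσs s h1.le) (hτs s h1.le)
    simpa using this

end TraceHoelder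

/-! ### Polar decomposition and duality for Schatten norms. -/

section SchattenNorm

variable {H : Type*} [NormedAddCommGroup H] [InnerProductSpace ℂ H] [FiniteDimensional ℂ H]

lemma opTrace_of_nonneg {A : H →L[ℂ] H} (hA : 0 ≤ A) :
    0 ≤ (opTrace A).re ∧ ((opTrace A).re : ℂ) = opTrace A := by
  obtain ⟨b, l, hl, hb⟩ := exists_eigenbasis hA
  rw [opTrace_eq_sum_eigenvalues b hb, ← Complex.ofReal_sum, Complex.ofReal_re]
  exact ⟨Finset.sum_nonneg fun i _ => hl i, rfl⟩

lemma eq_zero_of_opTrace_re_eq_zero {A : H →L[ℂ] H} (hA : 0 ≤ A) (h : (opTrace A).re = 0) :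
    A = 0 := by
  obtain ⟨b, l, hl, hb⟩ := exists_eigenbasis hA
  rw [opTrace_eq_sum_eigenvalues b hb, ← Complex.ofReal_sum, Complex.ofReal_re,
    Finset.sum_eq_zero_iff_of_nonneg fun i _ => hl i] at h
  refine ContinuousLinearMap.coe_injective (b.toBasis.ext fun i => ?_)
  simp [hb, h i]

lemma opTrace_star (A : H →L[ℂ] H) : opTrace (star A) = star (opTrace A) := by
  rw [opTrace_eq_sum_inner (stdOrthonormalBasis ℂ H),
    opTrace_eq_sum_inner (stdOrthonormalBasis ℂ H),
    star_sum]
  refine Finset.sum_congr rfl fun i _ => ?_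
  rw [ContinuousLinearMap.star_eq_adjoint, ContinuousLinearMap.adjoint_inner_right]
  exact (inner_conj_symm _ _).symm

/-- W = T |T|^(-1), with the inverse taken on the support of |T|; then W*W is the support projection
P of |T|. -/
lemma exists_polar (T : H →L[ℂ] H) :
    ∃ W : H →L[ℂ] H, ‖W‖ ≤ 1 ∧ W * CFC.abs T = T ∧ star W * T = CFC.abs T := by
  have hA : 0 ≤ CFC.abs T := CFC.abs_nonneg T
  have hsq := CFC.abs_mul_abs T
  set A := CFC.abs T with hAdef
  have hst : star (spow A (-1)) = spow A (-1) := by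
    simpa using star_spow hA (-1)
  have h0 : spow A (-1) * A = spow A 0 := by
    conv_lhs => enter [2]; rw [← spow_one hA]
    rw [← spow_add]; simp
  have h0' : A * spow A (-1) = spow A 0 := by
    conv_lhs => enter [1]; rw [← spow_one hA]
    rw [← spow_add]; simp
  have hs0 : star (spow A 0) = spow A 0 := by simpa using star_spow hA 0
  have hWT : star (T * spow A (-1)) * T = A := by
    rw [star_mul, hst, mul_assoc, ← hsq, ← mul_assoc, h0, spow_zero_mul hA]
  refine ⟨T * spow A (-1), ?_, ?_, hWT⟩
  · have : ‖T * spow A (-1)‖ * ‖T * spow A (-1)‖ ≤ 1 := by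
      rw [← CStarRing.norm_star_mul_self, ← mul_assoc, hWT, h0']
      exact norm_spow_zero_le_one A
    nlinarith [norm_nonneg (T * spow A (-1))]
  -- Here W |T| = T P. The difference T P - T vanishes because multiplying it on the left by its
  -- adjoint gives 0, P fixing |T|² from both sides.
  · rw [mul_assoc, h0, ← sub_eq_zero, ← CStarRing.star_mul_self_eq_zero_iff]
    have e1 : star T * T * spow A 0 = star T * T := by
      rw [← hsq, mul_assoc, mul_spow_zero hA]
    have e2 : spow A 0 * (star T * T) = star T * T := by
      rw [← hsq, ← mul_assoc, spow_zero_mul hA]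
    simp only [star_sub, star_mul, hs0, sub_mul, mul_sub]
    rw [mul_assoc (spow A 0) (star T) (T * _), ← mul_assoc (star T) T, e1, e2,
      mul_assoc (spow A 0), e2]
    simp

lemma abs_rpow_eq_spow (T : H →L[ℂ] H) {r : ℝ} (hr : 0 < r) :
    CFC.abs T ^ r = spow (CFC.abs T) r :=
  rpow_eq_spow (CFC.abs_nonneg T) hr

lemma schattenNorm_nonneg (r : ℝ) (T : H →L[ℂ] H) : 0 ≤ schattenNorm r T :=
  Real.rpow_nonneg (opTrace_of_nonneg CFC.rpow_nonneg).1 _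

lemma schattenNorm_zero {r : ℝ} (hr : 0 < r) : schattenNorm r (0 : H →L[ℂ] H) = 0 := by
  have h : (0 : H →L[ℂ] H) ^ r = 0 := CFC.zero_rpow hr.ne'
  simp [schattenNorm, h, opTrace_zero, hr.ne']

/-- A multiple of a contraction times a power of a state: the normal form behind all Schatten norm
estimates. -/
lemma exists_schatten_polar {ρ : H →L[ℂ] H} (hρ : IsState ρ) {r : ℝ} (hr : 0 < r)
    (T : H →L[ℂ] H) : ∃ W τ : H →L[ℂ] H, ‖W‖ ≤ 1 ∧ IsState τ ∧
      T = (schattenNorm r T : ℂ) • (W * spow τ (1 / r : ℝ)) ∧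
      star W * T = (schattenNorm r T : ℂ) • spow τ (1 / r : ℝ) := by
  rcases eq_or_ne T 0 with rfl | hT
  -- |T|^r cannot be normalised when T = 0; the given ρ then serves as the state.
  · exact ⟨0, ρ, by simp, hρ, by simp, by simp [schattenNorm_zero hr]⟩
  obtain ⟨W, hW, h1, h2⟩ := exists_polar T
  have hA : 0 ≤ CFC.abs T := CFC.abs_nonneg T
  have hAr : 0 ≤ spow (CFC.abs T) r := spow_nonneg hA r
  obtain ⟨hN0, hN⟩ := opTrace_of_nonneg hAr
  have hback : spow (spow (CFC.abs T) r) (1 / r : ℝ) = CFC.abs T := by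
    rw [spow_spow hA, ← Complex.ofReal_mul, mul_one_div_cancel hr.ne', Complex.ofReal_one,
      spow_one hA]
  have hNpos : 0 < (opTrace (spow (CFC.abs T) r)).re := by
    refine hN0.lt_of_ne' fun h => hT ?_
    have h3 := eq_zero_of_opTrace_re_eq_zero hAr h
    have h4 : CFC.abs T = 0 := by
      rw [← hback, h3, spow, cfc_apply_zero]; simp [powFun]
    exact CFC.abs_eq_zero_iff.mp h4
  have hnorm : schattenNorm r T = (opTrace (spow (CFC.abs T) r)).re ^ (1 / r) := by
    rw [schattenNorm, abs_rpow_eq_spow T hr]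
  set N := (opTrace (spow (CFC.abs T) r)).re with hNdef
  have hτ : spow (((N⁻¹ : ℝ) : ℂ) • spow (CFC.abs T) r) (1 / r : ℝ) =
      ((N ^ (1 / r))⁻¹ : ℝ) • CFC.abs T := by
    rw [spow_smul hAr (inv_pos.mpr hNpos), hback, ← Complex.ofReal_cpow (inv_nonneg.mpr hN0),
      Real.inv_rpow hN0]
    rfl
  have hmul : CFC.abs T = (schattenNorm r T : ℂ) •
      spow (((N⁻¹ : ℝ) : ℂ) • spow (CFC.abs T) r) (1 / r : ℝ) := by
    rw [hτ, hnorm, ← Complex.coe_smul, smul_smul, ← Complex.ofReal_mul,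
      mul_inv_cancel₀ (Real.rpow_pos_of_pos hNpos _).ne']
    simp
  refine ⟨W, ((N⁻¹ : ℝ) : ℂ) • spow (CFC.abs T) r, hW, ⟨?_, ?_⟩, ?_, ?_⟩
  · rw [← ContinuousLinearMap.nonneg_iff_isPositive, Complex.coe_smul]
    exact smul_nonneg (inv_nonneg.mpr hN0) hAr
  · rw [opTrace_smul, ← hN, ← Complex.ofReal_mul, inv_mul_cancel₀ hNpos.ne', Complex.ofReal_one]
  · rw [← mul_smul_comm, ← hmul, h1]
  · rw [← hmul, h2]

/-- The upper half of the duality: in polar form T contributes a state to the power 1/r, and the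
two-state bound applies. -/
lemma norm_opTrace_le_schattenNorm {τ : H →L[ℂ] H} (hτ : IsState τ) {r : ℝ} (hr : 1 ≤ r)
    (T U V : H →L[ℂ] H) {w : ℂ} (hw : w.re = 1 - 1 / r) :
    ‖opTrace (U * T * V * spow τ w)‖ ≤ ‖U‖ * ‖V‖ * schattenNorm r T := by
  have hr0 : 0 < r := by linarith
  obtain ⟨W, σ, hW, hσ, h1, -⟩ := exists_schatten_polar hτ hr0 T
  have hr1 : 1 / r ≤ 1 := by rw [div_le_one hr0]; exact hr
  have h := norm_opTrace_spow_mul₂_le hσ hτ V (U * W) (z := (1 / r : ℝ)) (w := w)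
    (by rw [Complex.ofReal_re]; positivity) (by rw [hw]; linarith)
    (by rw [hw, Complex.ofReal_re]; ring)
  have e : opTrace (U * T * V * spow τ w) =
      schattenNorm r T * opTrace (spow σ (1 / r : ℝ) * V * spow τ w * (U * W)) := by
    conv_lhs => rw [h1]
    rw [opTrace_mul_comm _ (U * W), ← opTrace_smul]
    simp only [mul_smul_comm, smul_mul_assoc, mul_assoc]
  rw [e, norm_mul, Complex.norm_real, Real.norm_of_nonneg (schattenNorm_nonneg r T), mul_comm]
  refine mul_le_mul_of_nonneg_right (h.trans ?_) (schattenNorm_nonneg r T)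
  have : ‖U * W‖ ≤ ‖U‖ * 1 := norm_mul_le_of_le le_rfl hW
  nlinarith [norm_nonneg V]

/-- The duality is attained at U = W* and the state of the polar form of T: the powers 1/r and 1 -
1/r multiply to τ, of trace one. -/
lemma exists_opTrace_eq_schattenNorm {ρ : H →L[ℂ] H} (hρ : IsState ρ) {r : ℝ} (hr : 0 < r)
    (T : H →L[ℂ] H) : ∃ U τ : H →L[ℂ] H, ‖U‖ ≤ 1 ∧ IsState τ ∧
      opTrace (U * T * spow τ (1 - 1 / r : ℝ)) = schattenNorm r T := by
  obtain ⟨W, τ, hW, hτ, -, h2⟩ := exists_schatten_polar hρ hr T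
  refine ⟨star W, τ, by rwa [norm_star], hτ, ?_⟩
  rw [h2, smul_mul_assoc, ← spow_add, ← Complex.ofReal_add, add_sub_cancel, Complex.ofReal_one,
    spow_one hτ.nonneg, opTrace_smul, hτ.2, mul_one]

lemma schattenNorm_le_star {ρ : H →L[ℂ] H} (hρ : IsState ρ) {r : ℝ} (hr : 1 ≤ r)
    (T : H →L[ℂ] H) : schattenNorm r T ≤ schattenNorm r (star T) := by
  obtain ⟨U, τ, hU, hτ, h⟩ := exists_opTrace_eq_schattenNorm hρ (by linarith : 0 < r) T
  have h1 := norm_opTrace_le_schattenNorm hτ hr (star T) 1 (star U) (w := (1 - 1 / r : ℝ))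
    (Complex.ofReal_re _)
  have e : opTrace (1 * star T * star U * spow τ (1 - 1 / r : ℝ)) = schattenNorm r T := by
    rw [opTrace_mul_comm, one_mul]
    conv_lhs => enter [1, 1]; rw [← star_spow hτ.nonneg]
    rw [← star_mul, ← star_mul, opTrace_star, h]
    simp
  rw [e, Complex.norm_real, Real.norm_of_nonneg (schattenNorm_nonneg r T), norm_star] at h1
  refine h1.trans (mul_le_of_le_one_left (schattenNorm_nonneg _ _) ?_)
  exact mul_le_one₀ ContinuousLinearMap.norm_id_le (norm_nonneg _) hU

lemma schattenNorm_star {ρ : H →L[ℂ] H} (hρ : IsState ρ) {r : ℝ} (hr : 1 ≤ r)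
    (T : H →L[ℂ] H) : schattenNorm r (star T) = schattenNorm r T :=
  le_antisymm (by simpa using schattenNorm_le_star hρ hr (star T)) (schattenNorm_le_star hρ hr T)

lemma schattenNorm_eq_zero_iff {ρ : H →L[ℂ] H} (hρ : IsState ρ) {r : ℝ} (hr : 0 < r)
    {T : H →L[ℂ] H} : schattenNorm r T = 0 ↔ T = 0 := by
  refine ⟨fun h => ?_, fun h => h ▸ schattenNorm_zero hr⟩
  obtain ⟨W, τ, -, -, h1, -⟩ := exists_schatten_polar hρ hr T
  rw [h1, h]
  simp

/-- Two independent bases are allowed so that one can diagonalise ρ and the other σ. -/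
lemma schattenNorm_two_sq {ι κ : Type*} [Fintype ι] [Fintype κ] (b : OrthonormalBasis ι ℂ H)
    (c : OrthonormalBasis κ ℂ H) (T : H →L[ℂ] H) :
    schattenNorm 2 T ^ 2 = ∑ j, ∑ i, ‖inner ℂ (b i) (T (c j))‖ ^ 2 := by
  have h2 : CFC.abs T ^ (2 : ℝ) = star T * T := by
    have := CFC.rpow_natCast (CFC.abs T) 2 (CFC.abs_nonneg T)
    rw [← CFC.abs_sq, ← this]; norm_num
  have h0 : 0 ≤ (opTrace (star T * T)).re := (opTrace_of_nonneg (star_mul_self_nonneg T)).1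
  rw [schattenNorm, h2, ← Real.sqrt_eq_rpow, Real.sq_sqrt h0, opTrace_eq_sum_inner c,
    Complex.re_sum]
  refine Finset.sum_congr rfl fun j _ => ?_
  rw [b.sum_sq_norm_inner_right, mul_apply_eq_comp, ContinuousLinearMap.star_eq_adjoint,
    ContinuousLinearMap.adjoint_inner_right, inner_self_eq_norm_sq_to_K]
  norm_cast

end SchattenNorm

/-! ### Positivity, monotonicity, range, symmetry and log-convexity. -/

section Correlator

variable {H : Type*} [NormedAddCommGroup H] [InnerProductSpace ℂ H] [FiniteDimensional ℂ H]

lemma correlator_eq {ρ : H →L[ℂ] H} (hρ : 0 ≤ ρ) (O : H →L[ℂ] H) {p q : ℝ} (hp : 0 < p)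
    (hq : 0 < q) : correlator p q O ρ =
      schattenNorm (2 / (p + q)) (spow ρ (p / 2 : ℝ) * O * spow ρ (q / 2 : ℝ)) := by
  rw [correlator, rpow_eq_spow hρ (half_pos hp), rpow_eq_spow hρ (half_pos hq)]

lemma correlator_nonneg (O ρ : H →L[ℂ] H) (p q : ℝ) : 0 ≤ correlator p q O ρ :=
  schattenNorm_nonneg _ _

lemma one_le_two_div {p q : ℝ} (hp : p ∈ Set.Ioc (0 : ℝ) 1) (hq : q ∈ Set.Ioc (0 : ℝ) 1) :
    1 ≤ 2 / (p + q) := by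
  rw [le_div_iff₀ (add_pos hp.1 hq.1)]
  linarith [hp.2, hq.2]

/-- With P the support projection, x - P x lies in the kernel, so it is orthogonal to x; it is also
orthogonal to P x, hence to itself. -/
lemma spow_zero_apply_of_mem_supp {ρ : H →L[ℂ] H} (hρ : 0 ≤ ρ) {x : H} (hx : x ∈ supp ρ) :
    spow ρ 0 x = x := by
  have hk : x - spow ρ 0 x ∈ LinearMap.ker (ρ : H →ₗ[ℂ] H) := by
    have : (ρ * spow ρ 0) x = ρ x := by rw [mul_spow_zero hρ]
    rw [LinearMap.mem_ker, map_sub]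
    exact sub_eq_zero.mpr this.symm
  have h1 : inner ℂ (x - spow ρ 0 x) x = 0 := (Submodule.mem_orthogonal _ _).mp hx _ hk
  have h0 : (0 : H →L[ℂ] H) ≤ spow ρ 0 := by simpa using spow_nonneg hρ 0
  have h2 : inner ℂ (x - spow ρ 0 x) (spow ρ 0 x) = 0 := by
    rw [← inner_apply_eq_of_nonneg h0, map_sub]
    have : (spow ρ 0 * spow ρ 0) x = spow ρ 0 x := by rw [spow_zero_mul_spow]
    rw [mul_apply_eq_comp] at this
    rw [this, sub_self, inner_zero_left]
  have h3 : inner ℂ (x - spow ρ 0 x) (x - spow ρ 0 x) = (0 : ℂ) := by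
    rw [inner_sub_right, h1, h2, sub_zero]
  exact (sub_eq_zero.mp (inner_self_eq_zero.mp h3)).symm

lemma spow_zero_apply_mem_supp {ρ : H →L[ℂ] H} (hρ : 0 ≤ ρ) (x : H) : spow ρ 0 x ∈ supp ρ := by
  refine (Submodule.mem_orthogonal _ _).mpr fun y hy => ?_
  have h0 : (0 : H →L[ℂ] H) ≤ spow ρ 0 := by simpa using spow_nonneg hρ 0
  have hy0 : ρ y = (0 : ℂ) • y := by rw [zero_smul]; exact hy
  rw [← inner_apply_eq_of_nonneg h0, spow_apply_of_eigenvector hρ 0 hy0]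
  simp [powFun]

lemma correlator_eq_zero_iff {ρ : H →L[ℂ] H} (hρ : IsState ρ) (O : H →L[ℂ] H) {p q : ℝ}
    (hp : 0 < p) (hq : 0 < q) :
    correlator p q O ρ = 0 ↔ (supp ρ).map (O : H →ₗ[ℂ] H) ≤ (supp ρ)ᗮ := by
  -- Negative powers cancel the positive ones down to the support projection, so the exponents play
  -- no role in the vanishing.
  have hsupp : spow ρ (p / 2 : ℝ) * O * spow ρ (q / 2 : ℝ) = 0 ↔
      spow ρ 0 * O * spow ρ 0 = 0 := by
    constructor
    · intro h
      have e : spow ρ 0 * O * spow ρ 0 = spow ρ (-(p / 2 : ℝ)) *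
          (spow ρ (p / 2 : ℝ) * O * spow ρ (q / 2 : ℝ)) * spow ρ (-(q / 2 : ℝ)) := by
        rw [mul_assoc (spow ρ (p / 2 : ℝ)), ← mul_assoc, ← spow_add,
          mul_assoc _ (O * _), mul_assoc O, ← spow_add, neg_add_cancel, add_neg_cancel, mul_assoc]
      rw [e, h, mul_zero, zero_mul]
    · intro h
      have e : spow ρ (p / 2 : ℝ) * O * spow ρ (q / 2 : ℝ) = spow ρ (p / 2 : ℝ) *
          (spow ρ 0 * O * spow ρ 0) * spow ρ (q / 2 : ℝ) := by
        rw [mul_assoc (spow ρ 0), ← mul_assoc, spow_mul_spow_zero,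
          mul_assoc _ (O * _), mul_assoc O, spow_zero_mul_spow, mul_assoc]
      rw [e, h, mul_zero, zero_mul]
  rw [correlator_eq hρ.nonneg O hp hq, schattenNorm_eq_zero_iff hρ (by positivity), hsupp]
  have h0 : (0 : H →L[ℂ] H) ≤ spow ρ 0 := by simpa using spow_nonneg hρ.nonneg 0
  constructor
  · rintro h _ ⟨x, hx, rfl⟩
    refine (Submodule.mem_orthogonal _ _).mpr fun y hy => ?_
    have := congrArg (fun A : H →L[ℂ] H => inner ℂ y (A x)) h
    simpa [← inner_apply_eq_of_nonneg h0, spow_zero_apply_of_mem_supp hρ.nonneg hx,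
      spow_zero_apply_of_mem_supp hρ.nonneg hy] using this
  · intro h
    ext x
    refine ext_inner_left ℂ fun y => ?_
    have := (Submodule.mem_orthogonal _ _).mp
      (h ⟨spow ρ 0 x, spow_zero_apply_mem_supp hρ.nonneg x, rfl⟩) (spow ρ 0 y)
      (spow_zero_apply_mem_supp hρ.nonneg y)
    simpa [← inner_apply_eq_of_nonneg h0] using this

/-- Hölder with ρ^a of norm one in the Schatten class of exponent 1/a. With the dual state τ, the
exponents a, 1/r and 1 - 1/s sum to 1. -/
lemma schattenNorm_spow_mul_le {ρ : H →L[ℂ] H} (hρ : IsState ρ) (T : H →L[ℂ] H) {a r s : ℝ}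
    (ha : 0 ≤ a) (hr : 0 < r) (hs : 1 ≤ s) (h : 1 / s = a + 1 / r) :
    schattenNorm s (spow ρ a * T) ≤ schattenNorm r T := by
  have hs0 : 0 < s := by linarith
  have hs1 : 1 / s ≤ 1 := by rw [div_le_one hs0]; exact hs
  obtain ⟨U, τ, hU, hτ, hUτ⟩ := exists_opTrace_eq_schattenNorm hρ hs0 (spow ρ a * T)
  obtain ⟨W, σ, hW, hσ, hT, -⟩ := exists_schatten_polar hρ hr T
  have h3 := norm_opTrace_spow_mul₃_le hρ hσ hτ W 1 U ha (one_div_pos.mpr hr).le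
    (sub_nonneg.mpr hs1) (by linarith)
  have e : (schattenNorm s (spow ρ a * T) : ℂ) = schattenNorm r T *
      opTrace (spow ρ a * W * spow σ (1 / r : ℝ) * 1 * spow τ (1 - 1 / s : ℝ) * U) := by
    rw [← hUτ, mul_assoc, opTrace_mul_comm]
    conv_lhs => rw [hT]
    rw [← opTrace_smul, mul_one]
    simp only [mul_smul_comm, smul_mul_assoc, mul_assoc]
  have e' := congrArg norm e
  rw [norm_mul, Complex.norm_real, Complex.norm_real, Real.norm_of_nonneg (schattenNorm_nonneg _ _),
    Real.norm_of_nonneg (schattenNorm_nonneg _ _)] at e'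
  rw [e']
  refine mul_le_of_le_one_right (schattenNorm_nonneg _ _) (h3.trans ?_)
  exact mul_le_one₀ (mul_le_one₀ hW (norm_nonneg _) ContinuousLinearMap.norm_id_le)
    (norm_nonneg _) hU

lemma correlator_antitone_left {ρ : H →L[ℂ] H} (hρ : IsState ρ) (O : H →L[ℂ] H) {q : ℝ}
    (hq : q ∈ Set.Ioc (0 : ℝ) 1) :
    AntitoneOn (fun p => correlator p q O ρ) (Set.Ioc (0 : ℝ) 1) := by
  intro p hp p' hp' hpp
  have h1 := hp.1
  have h2 := hq.1
  have h3 := hp'.1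
  simp only [correlator_eq hρ.nonneg O h1 h2, correlator_eq hρ.nonneg O h3 h2]
  have e : spow ρ (p' / 2 : ℝ) * O * spow ρ (q / 2 : ℝ) = spow ρ ((p' - p) / 2 : ℝ) *
      (spow ρ (p / 2 : ℝ) * O * spow ρ (q / 2 : ℝ)) := by
    simp only [← mul_assoc]
    rw [← spow_add, ← Complex.ofReal_add]
    congr 4; ring
  rw [e]
  refine schattenNorm_spow_mul_le hρ _ (by linarith) (by positivity) (one_le_two_div hp' hq) ?_
  rw [one_div_div, one_div_div]; ring

lemma correlator_adjoint {ρ : H →L[ℂ] H} (hρ : IsState ρ) (O : H →L[ℂ] H) {p q : ℝ}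
    (hp : p ∈ Set.Ioc (0 : ℝ) 1) (hq : q ∈ Set.Ioc (0 : ℝ) 1) :
    correlator p q O ρ = correlator q p (ContinuousLinearMap.adjoint O) ρ := by
  rw [correlator_eq hρ.nonneg O hp.1 hq.1, correlator_eq hρ.nonneg _ hq.1 hp.1,
    ← schattenNorm_star hρ (one_le_two_div hp hq), star_mul, star_mul, star_spow hρ.nonneg,
    star_spow hρ.nonneg, ContinuousLinearMap.star_eq_adjoint, mul_assoc, add_comm p q]

lemma correlator_antitone_right {ρ : H →L[ℂ] H} (hρ : IsState ρ) (O : H →L[ℂ] H) {p : ℝ}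
    (hp : p ∈ Set.Ioc (0 : ℝ) 1) :
    AntitoneOn (fun q => correlator p q O ρ) (Set.Ioc (0 : ℝ) 1) := by
  intro q hq q' hq' hqq
  have := correlator_antitone_left hρ (ContinuousLinearMap.adjoint O) hp hq hq' hqq
  simpa only [← correlator_adjoint hρ O hp hq, ← correlator_adjoint hρ O hp hq'] using this

/-- The two powers of ρ and the dual power of τ have exponents p/2, q/2 and 1 - (p+q)/2, so the
three-state bound applies. -/
lemma correlator_le_norm {ρ : H →L[ℂ] H} (hρ : IsState ρ) (O : H →L[ℂ] H) {p q : ℝ}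
    (hp : p ∈ Set.Ioc (0 : ℝ) 1) (hq : q ∈ Set.Ioc (0 : ℝ) 1) : correlator p q O ρ ≤ ‖O‖ := by
  have h1 := hp.1
  have h2 := hq.1
  rw [correlator_eq hρ.nonneg O h1 h2]
  obtain ⟨U, τ, hU, hτ, hUτ⟩ := exists_opTrace_eq_schattenNorm hρ
    (r := 2 / (p + q)) (by positivity) (spow ρ (p / 2 : ℝ) * O * spow ρ (q / 2 : ℝ))
  have h3 := norm_opTrace_spow_mul₃_le hρ hρ hτ O 1 U (half_pos h1).le (half_pos h2).le
    (c := 1 - 1 / (2 / (p + q))) (by rw [one_div_div]; linarith [hp.2, hq.2])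
    (by rw [one_div_div]; ring)
  rw [mul_one, opTrace_mul_comm, ← mul_assoc, hUτ, Complex.norm_real,
    Real.norm_of_nonneg (schattenNorm_nonneg _ _)] at h3
  refine h3.trans ?_
  rw [mul_assoc]
  exact mul_le_of_le_one_right (norm_nonneg _)
    (mul_le_one₀ ContinuousLinearMap.norm_id_le (norm_nonneg _) hU)

lemma norm_opTrace_mul_le_correlator {ρ : H →L[ℂ] H} (hρ : IsState ρ) (O : H →L[ℂ] H) {p q : ℝ}
    (hp : p ∈ Set.Ioc (0 : ℝ) 1) (hq : q ∈ Set.Ioc (0 : ℝ) 1) :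
    ‖opTrace (ρ * O)‖ ≤ correlator p q O ρ := by
  have h11 : (1 : ℝ) ∈ Set.Ioc (0 : ℝ) 1 := by simp
  -- By monotonicity only p = q = 1 matters, where the bound is |Tr X| ≤ ‖X‖₁ for X = ρ^(1/2) O
  -- ρ^(1/2).
  refine le_trans ?_ ((correlator_antitone_left hρ O h11 hp h11 hp.2).trans
    (correlator_antitone_right hρ O hp hq h11 hq.2))
  simp only [correlator_eq hρ.nonneg O one_pos one_pos]
  have hr : (2 : ℝ) / (1 + 1) = 1 := by norm_num
  rw [hr]
  obtain ⟨W, τ, hW, hτ, hT, -⟩ := exists_schatten_polar hρ one_pos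
    (spow ρ (1 / 2 : ℝ) * O * spow ρ (1 / 2 : ℝ))
  have e : opTrace (ρ * O) = opTrace (spow ρ (1 / 2 : ℝ) * O * spow ρ (1 / 2 : ℝ)) := by
    rw [opTrace_mul_comm _ (spow ρ (1 / 2 : ℝ)), ← mul_assoc, ← spow_add, ← Complex.ofReal_add]
    norm_num [spow_one hρ.nonneg]
  rw [e]
  conv_lhs => rw [hT]
  rw [opTrace_smul, norm_mul, Complex.norm_real, Real.norm_of_nonneg (schattenNorm_nonneg _ _),
    opTrace_mul_comm]
  refine mul_le_of_le_one_right (schattenNorm_nonneg _ _) ?_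
  exact (hτ.norm_opTrace_spow_mul_le (by simp) W).trans hW

/-- Serves as the edge bound for log-convexity: the imaginary powers of ρ are contractions, absorbed
into the operators on either side. -/
lemma norm_opTrace_le_correlator {ρ τ : H →L[ℂ] H} (hρ : IsState ρ) (hτ : IsState τ)
    (O U : H →L[ℂ] H) (hU : ‖U‖ ≤ 1) {p q : ℝ} (hp : p ∈ Set.Ioc (0 : ℝ) 1)
    (hq : q ∈ Set.Ioc (0 : ℝ) 1) {z₁ z₂ w : ℂ} (h₁ : z₁.re = p / 2) (h₂ : z₂.re = q / 2)
    (hw : w.re = 1 - (p + q) / 2) :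
    ‖opTrace (U * spow ρ z₁ * O * spow ρ z₂ * spow τ w)‖ ≤ correlator p q O ρ := by
  rw [correlator_eq hρ.nonneg O hp.1 hq.1]
  have h := norm_opTrace_le_schattenNorm hτ (one_le_two_div hp hq)
    (spow ρ (p / 2 : ℝ) * O * spow ρ (q / 2 : ℝ)) (U * spow ρ (z₁ - (p / 2 : ℝ)))
    (spow ρ (z₂ - (q / 2 : ℝ))) (w := w) (by rw [one_div_div, hw])
  have e : U * spow ρ (z₁ - (p / 2 : ℝ)) * (spow ρ (p / 2 : ℝ) * O * spow ρ (q / 2 : ℝ)) *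
      spow ρ (z₂ - (q / 2 : ℝ)) * spow τ w = U * spow ρ z₁ * O * spow ρ z₂ * spow τ w := by
    have e1 : spow ρ z₁ = spow ρ (z₁ - (p / 2 : ℝ)) * spow ρ (p / 2 : ℝ) := by
      rw [← spow_add, sub_add_cancel]
    have e2 : spow ρ z₂ = spow ρ (q / 2 : ℝ) * spow ρ (z₂ - (q / 2 : ℝ)) := by
      rw [← spow_add, add_sub_cancel]
    rw [e1, e2]
    simp only [mul_assoc]
  rw [e] at h
  refine h.trans (mul_le_of_le_one_left (schattenNorm_nonneg _ _) (mul_le_one₀ ?_ (norm_nonneg _)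
    (hρ.norm_spow_le_one (z := z₂ - (q / 2 : ℝ)) (by
      rw [Complex.sub_re, h₂, Complex.ofReal_re, sub_self]))))
  simpa using norm_mul_le_of_le hU
    (hρ.norm_spow_le_one (z := z₁ - (p / 2 : ℝ)) (by
    rw [Complex.sub_re, h₁, Complex.ofReal_re, sub_self]))

/-- The dual pair U, τ is chosen at the intermediate exponents and kept fixed while the exponents
move affinely in s; each edge is bounded by the corresponding endpoint correlator. -/
lemma correlator_log_convex {ρ : H →L[ℂ] H} (hρ : IsState ρ) (O : H →L[ℂ] H) {p₀ q₀ p₁ q₁ : ℝ}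
    (hp₀ : p₀ ∈ Set.Ioc (0 : ℝ) 1) (hq₀ : q₀ ∈ Set.Ioc (0 : ℝ) 1) (hp₁ : p₁ ∈ Set.Ioc (0 : ℝ) 1)
    (hq₁ : q₁ ∈ Set.Ioc (0 : ℝ) 1) {θ : ℝ} (hθ : θ ∈ Set.Icc (0 : ℝ) 1) :
    correlator ((1 - θ) * p₀ + θ * p₁) ((1 - θ) * q₀ + θ * q₁) O ρ ≤
      correlator p₀ q₀ O ρ ^ (1 - θ) * correlator p₁ q₁ O ρ ^ θ := by
  have hconv : ∀ {x y : ℝ}, x ∈ Set.Ioc (0 : ℝ) 1 → y ∈ Set.Ioc (0 : ℝ) 1 → ∀ {t : ℝ}, 0 ≤ t →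
      t ≤ 1 → (1 - t) * x + t * y ∈ Set.Ioc (0 : ℝ) 1 := fun hx hy t h0 h1 =>
    (convex_Ioc (0 : ℝ) 1) hx hy (by linarith) h0 (by ring)
  have hp := hconv hp₀ hp₁ hθ.1 hθ.2
  have hq := hconv hq₀ hq₁ hθ.1 hθ.2
  have hpp := hp.1
  have hqp := hq.1
  rw [correlator_eq hρ.nonneg O hpp hqp]
  obtain ⟨U, τ, hU, hτ, hUτ⟩ := exists_opTrace_eq_schattenNorm hρ
    (r := 2 / (((1 - θ) * p₀ + θ * p₁) + ((1 - θ) * q₀ + θ * q₁))) (by positivity)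
    (spow ρ (((1 - θ) * p₀ + θ * p₁) / 2 : ℝ) * O * spow ρ (((1 - θ) * q₀ + θ * q₁) / 2 : ℝ))
  have hd : Differentiable ℂ fun s : ℂ => U * spow ρ (((1 - s) * p₀ + s * p₁) / 2) * O *
      spow ρ (((1 - s) * q₀ + s * q₁) / 2) *
      spow τ (1 - (((1 - s) * p₀ + s * p₁) + ((1 - s) * q₀ + s * q₁)) / 2) := by
    have h1 := differentiable_spow ρ
    have h2 := differentiable_spow τ
    exact ((((differentiable_const U).mul (h1.comp (by fun_prop))).mul_const O).mul
      (h1.comp (by fun_prop))).mul (h2.comp (by fun_prop))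
  have key := norm_opTrace_le_of_strip hd (C := ‖O‖) ?_
    (fun s hs => norm_opTrace_le_correlator hρ hτ O U hU hp₀ hq₀ (by simp [hs]) (by simp [hs])
      (by simp [hs]))
    (fun s hs => norm_opTrace_le_correlator hρ hτ O U hU hp₁ hq₁ (by simp [hs]) (by simp [hs])
      (by simp [hs])) hθ.1 hθ.2
  · refine le_trans (le_of_eq ?_) key
    rw [← Real.norm_of_nonneg (schattenNorm_nonneg _ _), ← Complex.norm_real, ← hUτ]
    push_cast
    simp only [mul_assoc, one_div_div]
  · intro s h0 h1
    have hp := hconv hp₀ hp₁ h0 h1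
    have hq := hconv hq₀ hq₁ h0 h1
    have hn1 : ‖spow ρ (((1 - s) * p₀ + s * p₁) / 2)‖ ≤ 1 :=
      hρ.norm_spow_le_one (by simpa using (half_pos hp.1).le)
    have hn2 : ‖spow ρ (((1 - s) * q₀ + s * q₁) / 2)‖ ≤ 1 :=
      hρ.norm_spow_le_one (by simpa using (half_pos hq.1).le)
    have hn3 : ‖spow τ (1 - (((1 - s) * p₀ + s * p₁) + ((1 - s) * q₀ + s * q₁)) / 2)‖ ≤ 1 :=
      hτ.norm_spow_le_one (by simp; linarith [hp.2, hq.2])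
    simpa using norm_mul_le_of_le (norm_mul_le_of_le (norm_mul_le_of_le
      (norm_mul_le_of_le hU hn1) (le_refl ‖O‖)) hn2) hn3

lemma convexOn_log_correlator {ρ : H →L[ℂ] H} (hρ : IsState ρ) (O : H →L[ℂ] H)
    (h : ∀ p ∈ Set.Ioc (0 : ℝ) 1, ∀ q ∈ Set.Ioc (0 : ℝ) 1, correlator p q O ρ ≠ 0) :
    ConvexOn ℝ (Set.Ioc (0 : ℝ) 1 ×ˢ Set.Ioc (0 : ℝ) 1)
      (fun x : ℝ × ℝ => Real.log (correlator x.1 x.2 O ρ)) := by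
  have hpos : ∀ p ∈ Set.Ioc (0 : ℝ) 1, ∀ q ∈ Set.Ioc (0 : ℝ) 1, 0 < correlator p q O ρ :=
    fun p hp q hq => (correlator_nonneg O ρ p q).lt_of_ne' (h p hp q hq)
  have hconv := (convex_Ioc (𝕜 := ℝ) (0 : ℝ) 1).prod (convex_Ioc (𝕜 := ℝ) (0 : ℝ) 1)
  refine ⟨hconv, ?_⟩
  rintro ⟨p₀, q₀⟩ h₀ ⟨p₁, q₁⟩ h₁ a b ha hb hab
  obtain rfl : a = 1 - b := by linarith
  have hmem := hconv h₀ h₁ ha hb hab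
  have key := correlator_log_convex hρ O h₀.1 h₀.2 h₁.1 h₁.2 (θ := b) ⟨hb, by linarith⟩
  have hp0 := hpos p₀ h₀.1 q₀ h₀.2
  have hp1 := hpos p₁ h₁.1 q₁ h₁.2
  have := Real.log_le_log (hpos _ hmem.1 _ hmem.2) key
  rwa [Real.log_mul (Real.rpow_pos_of_pos hp0 _).ne' (Real.rpow_pos_of_pos hp1 _).ne',
    Real.log_rpow hp0, Real.log_rpow hp1] at this

end Correlator

/-! ### Hölder continuity in the Bures metric. -/

section Continuity

variable {H : Type*} [NormedAddCommGroup H] [InnerProductSpace ℂ H] [FiniteDimensional ℂ H]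

lemma norm_le_one_of_mem_unitary {u : H →L[ℂ] H} (hu : u ∈ unitary (H →L[ℂ] H)) : ‖u‖ ≤ 1 := by
  have h : ‖u‖ * ‖u‖ ≤ 1 := by
    rw [← CStarRing.norm_star_mul_self, Unitary.star_mul_self_of_mem hu]
    exact ContinuousLinearMap.norm_id_le
  nlinarith [norm_nonneg u]

lemma schattenNorm_add_le {ρ : H →L[ℂ] H} (hρ : IsState ρ) {r : ℝ} (hr : 1 ≤ r)
    (S T : H →L[ℂ] H) : schattenNorm r (S + T) ≤ schattenNorm r S + schattenNorm r T := by
  obtain ⟨U, τ, hU, hτ, h⟩ := exists_opTrace_eq_schattenNorm hρ (by linarith : 0 < r) (S + T)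
  have hb : ∀ X : H →L[ℂ] H, ‖opTrace (U * X * spow τ (1 - 1 / r : ℝ))‖ ≤ schattenNorm r X := by
    intro X
    have := norm_opTrace_le_schattenNorm hτ hr X U 1 (w := (1 - 1 / r : ℝ)) (Complex.ofReal_re _)
    rw [mul_one] at this
    exact this.trans (mul_le_of_le_one_left (schattenNorm_nonneg _ _)
      (mul_le_one₀ hU (norm_nonneg _) ContinuousLinearMap.norm_id_le))
  rw [← Real.norm_of_nonneg (schattenNorm_nonneg r (S + T)), ← Complex.norm_real, ← h, mul_add,
    add_mul, opTrace_add]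
  exact (norm_add_le _ _).trans (add_le_add (hb S) (hb T))

lemma schattenNorm_mul_mul_le {ρ : H →L[ℂ] H} (hρ : IsState ρ) {r : ℝ} (hr : 1 ≤ r)
    (T : H →L[ℂ] H) {V W : H →L[ℂ] H} (hV : ‖V‖ ≤ 1) (hW : ‖W‖ ≤ 1) :
    schattenNorm r (V * T * W) ≤ schattenNorm r T := by
  obtain ⟨U, τ, hU, hτ, h⟩ := exists_opTrace_eq_schattenNorm hρ (by linarith : 0 < r) (V * T * W)
  have := norm_opTrace_le_schattenNorm hτ hr T (U * V) W (w := (1 - 1 / r : ℝ))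
    (Complex.ofReal_re _)
  rw [← mul_assoc, ← mul_assoc] at h
  rw [h, Complex.norm_real, Real.norm_of_nonneg (schattenNorm_nonneg _ _)] at this
  refine this.trans (mul_le_of_le_one_left (schattenNorm_nonneg _ _)
      (mul_le_one₀ ?_ (norm_nonneg _) hW))
  simpa using norm_mul_le_of_le hU hV

lemma schattenNorm_smul_half_add_le {ρ : H →L[ℂ] H} (hρ : IsState ρ) {S T : H →L[ℂ] H} {d : ℝ}
    (hS : schattenNorm 2 S ≤ d) (hT : schattenNorm 2 T ≤ d) :
    schattenNorm 2 ((2⁻¹ : ℂ) • (S + T)) ≤ d := by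
  have h2 : ∀ X : H →L[ℂ] H, schattenNorm 2 ((2⁻¹ : ℂ) • X) ≤ 2⁻¹ * schattenNorm 2 X := by
    intro X
    refine (sq_le_sq₀ (schattenNorm_nonneg _ _)
      (mul_nonneg (by norm_num) (schattenNorm_nonneg _ _))).mp (le_of_eq ?_)
    rw [mul_pow, schattenNorm_two_sq (stdOrthonormalBasis ℂ H) (stdOrthonormalBasis ℂ H),
      schattenNorm_two_sq (stdOrthonormalBasis ℂ H) (stdOrthonormalBasis ℂ H), Finset.mul_sum]
    refine Finset.sum_congr rfl fun j _ => ?_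
    rw [Finset.mul_sum]
    refine Finset.sum_congr rfl fun i _ => ?_
    rw [smul_apply, inner_smul_right, norm_mul, mul_pow]
    simp
  have := schattenNorm_add_le hρ one_le_two S T
  linarith [h2 (S + T)]

lemma norm_powFun_ofReal {x : ℝ} (hx : 0 < x) (z : ℂ) : ‖powFun z x‖ = x ^ z.re := by
  rw [powFun, if_neg (by exact_mod_cast hx.ne'), Complex.norm_cpow_eq_rpow_re_of_pos hx]

lemma norm_powFun_half {x : ℝ} (hx : 0 ≤ x) {z : ℂ} (hz : z.re = 1) :
    ‖powFun (z / 2) x‖ = √x := by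
  rcases hx.eq_or_lt with rfl | h
  · simp [powFun]
  · rw [norm_powFun_ofReal h, Real.sqrt_eq_rpow]
    congr 1
    simp [hz]

/-- Mean value inequality: on Re z = 1 the derivative z t^(z-1) has modulus ‖z‖. -/
lemma norm_cpow_sub_cpow_le {x y : ℝ} (hx : 0 < x) (hy : 0 < y) {z : ℂ} (hz : z.re = 1) :
    ‖(x : ℂ) ^ z - (y : ℂ) ^ z‖ ≤ ‖z‖ * |x - y| := by
  have := Convex.norm_image_sub_le_of_norm_hasDerivWithin_le (f := fun t : ℝ => (t : ℂ) ^ z)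
    (f' := fun t : ℝ => z * (t : ℂ) ^ (z - 1)) (s := Set.Ioi 0) (C := ‖z‖) (x := y) (y := x)
    (fun t ht => ?_) (fun t ht => ?_) (convex_Ioi 0) hy hx
  · simpa using this
  · have h := (hasDerivAt_id (t : ℂ)).cpow_const (c := z)
      (Or.inl (by simpa using ht))
    simpa using h.comp_ofReal.hasDerivWithinAt
  · rw [norm_mul, Complex.norm_cpow_eq_rpow_re_of_pos ht]
    simp [hz]

lemma norm_powFun_half_sub_le {x y : ℝ} (hx : 0 ≤ x) (hy : 0 ≤ y) {z : ℂ} (hz : z.re = 1) :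
    ‖powFun (z / 2) x - powFun (z / 2) y‖ ≤ ‖z‖ * |√x - √y| := by
  -- Needed when x or y is 0, where the left side is a single square root.
  have h1 : 1 ≤ ‖z‖ := by
    have := Complex.abs_re_le_norm z
    rwa [hz, abs_one] at this
  have hsq : ∀ {t : ℝ}, 0 < t → powFun (z / 2) t = (√t : ℂ) ^ z := by
    intro t ht
    rw [powFun, if_neg (by exact_mod_cast ht.ne'), Real.sqrt_eq_rpow, Complex.ofReal_cpow ht.le,
      ← Complex.cpow_mul]
    · congr 1; push_cast; ring
    · rw [← Complex.ofReal_log ht.le, ← Complex.ofReal_mul, Complex.ofReal_im]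
      exact neg_lt_zero.mpr Real.pi_pos
    · rw [← Complex.ofReal_log ht.le, ← Complex.ofReal_mul, Complex.ofReal_im]
      exact Real.pi_pos.le
  rcases hx.eq_or_lt with rfl | hx'
  · have h0 : powFun (z / 2) ((0 : ℝ) : ℂ) = 0 := by simp [powFun]
    rw [h0, zero_sub, norm_neg, norm_powFun_half hy hz, Real.sqrt_zero, zero_sub, abs_neg,
      abs_of_nonneg (Real.sqrt_nonneg y)]
    exact le_mul_of_one_le_left (Real.sqrt_nonneg y) h1
  rcases hy.eq_or_lt with rfl | hy'
  · have h0 : powFun (z / 2) ((0 : ℝ) : ℂ) = 0 := by simp [powFun]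
    rw [h0, sub_zero, norm_powFun_half hx hz, Real.sqrt_zero, sub_zero,
      abs_of_nonneg (Real.sqrt_nonneg x)]
    exact le_mul_of_one_le_left (Real.sqrt_nonneg x) h1
  rw [hsq hx', hsq hy']
  exact norm_cpow_sub_cpow_le (Real.sqrt_pos.mpr hx') (Real.sqrt_pos.mpr hy') hz

lemma schattenNorm_two_le_of_forall_inner {ι κ : Type*} [Fintype ι] [Fintype κ]
    (b : OrthonormalBasis ι ℂ H) (c : OrthonormalBasis κ ℂ H) {S T : H →L[ℂ] H} {K : ℝ}
    (hK : 0 ≤ K)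
    (h : ∀ i j, ‖inner ℂ (b i) (T (c j))‖ ≤ K * ‖inner ℂ (b i) (S (c j))‖) :
    schattenNorm 2 T ≤ K * schattenNorm 2 S := by
  refine (sq_le_sq₀ (schattenNorm_nonneg _ _) (mul_nonneg hK (schattenNorm_nonneg _ _))).mp ?_
  rw [mul_pow, schattenNorm_two_sq b c, schattenNorm_two_sq b c, Finset.mul_sum]
  refine Finset.sum_le_sum fun j _ => ?_
  rw [Finset.mul_sum]
  refine Finset.sum_le_sum fun i _ => ?_
  rw [← mul_pow]
  exact pow_le_pow_left₀ (norm_nonneg _) (h i j) 2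

lemma inner_spow_apply_of_eigenvector {A : H →L[ℂ] H} (hA : 0 ≤ A) (z : ℂ) {l : ℝ} {v : H}
    (hv : A v = (l : ℂ) • v) (y : H) : inner ℂ v (spow A z y) = powFun z l * inner ℂ v y := by
  have hs : IsStarNormal A := (IsSelfAdjoint.of_nonneg hA).isStarNormal
  have h : star (spow A z) v = star (powFun z l) • v := by
    rw [spow, ← cfc_star]
    exact cfc_apply_of_eigenvector hs (fun x => star (powFun z x)) hv
  rw [← ContinuousLinearMap.adjoint_inner_left, ← ContinuousLinearMap.star_eq_adjoint, h,
    inner_smul_left]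
  simp

/-- In eigenbases of ρ and σ each entry of C is multiplied by a difference of eigenvalue powers, so
the scalar bound applies entrywise. -/
lemma schattenNorm_spow_mul_sub_mul_spow_le {ρ σ : H →L[ℂ] H} (hρ : 0 ≤ ρ) (hσ : 0 ≤ σ)
    (C : H →L[ℂ] H) {z : ℂ} (hz : z.re = 1) :
    schattenNorm 2 (spow ρ (z / 2) * C - C * spow σ (z / 2)) ≤
      ‖z‖ * schattenNorm 2 (spow ρ (1 / 2) * C - C * spow σ (1 / 2)) := by
  obtain ⟨b, l, hl, hb⟩ := exists_eigenbasis hρ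
  obtain ⟨c, m, hm, hc⟩ := exists_eigenbasis hσ
  have key : ∀ (w : ℂ) i j, inner ℂ (b i) ((spow ρ w * C - C * spow σ w) (c j)) =
      (powFun w (l i) - powFun w (m j)) * inner ℂ (b i) (C (c j)) := by
    intro w i j
    rw [sub_apply, inner_sub_right, mul_apply_eq_comp, mul_apply_eq_comp,
      inner_spow_apply_of_eigenvector hρ w (hb i), spow_apply_of_eigenvector hσ w (hc j), map_smul,
      inner_smul_right, sub_mul]
  have hhalf : ∀ {t : ℝ}, 0 ≤ t → powFun (1 / 2) t = ((√t : ℝ) : ℂ) := by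
    intro t ht
    have := powFun_ofReal ht (r := 1 / 2) (by norm_num)
    rw [Real.sqrt_eq_rpow, ← this]; norm_num
  refine schattenNorm_two_le_of_forall_inner b c (norm_nonneg z) fun i j => ?_
  rw [key, key, norm_mul, norm_mul, ← mul_assoc]
  refine mul_le_mul_of_nonneg_right ?_ (norm_nonneg _)
  rw [hhalf (hl i), hhalf (hm j), ← Complex.ofReal_sub, Complex.norm_real, Real.norm_eq_abs]
  exact norm_powFun_half_sub_le (hl i) (hm j) hz

/-- The same with sums of eigenvalue powers. No factor ‖z‖ appears: the triangle inequality gives √l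
+ √m, exactly the multiplier at exponent 1/2. -/
lemma schattenNorm_spow_mul_add_mul_spow_le {ρ σ : H →L[ℂ] H} (hρ : 0 ≤ ρ) (hσ : 0 ≤ σ)
    (C : H →L[ℂ] H) {z : ℂ} (hz : z.re = 1) :
    schattenNorm 2 (spow ρ (z / 2) * C + C * spow σ (z / 2)) ≤
      schattenNorm 2 (spow ρ (1 / 2) * C + C * spow σ (1 / 2)) := by
  obtain ⟨b, l, hl, hb⟩ := exists_eigenbasis hρ
  obtain ⟨c, m, hm, hc⟩ := exists_eigenbasis hσ
  have key : ∀ (w : ℂ) i j, inner ℂ (b i) ((spow ρ w * C + C * spow σ w) (c j)) =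
      (powFun w (l i) + powFun w (m j)) * inner ℂ (b i) (C (c j)) := by
    intro w i j
    rw [add_apply, inner_add_right, mul_apply_eq_comp, mul_apply_eq_comp,
      inner_spow_apply_of_eigenvector hρ w (hb i), spow_apply_of_eigenvector hσ w (hc j), map_smul,
      inner_smul_right, add_mul]
  have hhalf : ∀ {t : ℝ}, 0 ≤ t → powFun (1 / 2) t = ((√t : ℝ) : ℂ) := by
    intro t ht
    have := powFun_ofReal ht (r := 1 / 2) (by norm_num)
    rw [Real.sqrt_eq_rpow, ← this]; norm_num
  rw [← one_mul (schattenNorm 2 (spow ρ (1 / 2) * C + C * spow σ (1 / 2)))]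
  refine schattenNorm_two_le_of_forall_inner b c zero_le_one fun i j => ?_
  rw [key, key, norm_mul, norm_mul, one_mul]
  refine mul_le_mul_of_nonneg_right ?_ (norm_nonneg _)
  rw [hhalf (hl i), hhalf (hm j), ← Complex.ofReal_add, Complex.norm_real,
    Real.norm_of_nonneg (add_nonneg (Real.sqrt_nonneg _) (Real.sqrt_nonneg _)),
    ← norm_powFun_half (hl i) hz, ← norm_powFun_half (hm j) hz]
  exact norm_add_le _ _

lemma sqrt_eq_spow {ρ : H →L[ℂ] H} (hρ : 0 ≤ ρ) : CFC.sqrt ρ = spow ρ (1 / 2) := by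
  rw [CFC.sqrt_eq_rpow, rpow_eq_spow hρ (by norm_num)]
  norm_num

/-- The endpoint estimate: `ρ ^ (z / 2) - u σ ^ (z / 2)` is split as a commutator with `(u + 1) / 2`
and an anticommutator with `(u - 1) / 2`, both of which are Schur multipliers in the eigenbases. -/
lemma schattenNorm_two_spow_sub_le {ρ σ : H →L[ℂ] H} (hρ : IsState ρ) (hσ : IsState σ)
    {u : H →L[ℂ] H} (hu : u ∈ unitary (H →L[ℂ] H)) {z : ℂ} (hz : z.re = 1) :
    schattenNorm 2 (spow ρ (z / 2) - u * spow σ (z / 2)) ≤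
      (‖z‖ + 1) * schattenNorm 2 (CFC.sqrt ρ - u * CFC.sqrt σ) := by
  have huu : star u * u = 1 := Unitary.star_mul_self_of_mem hu
  have hun : ‖u‖ ≤ 1 := norm_le_one_of_mem_unitary hu
  rw [sqrt_eq_spow hρ.nonneg, sqrt_eq_spow hσ.nonneg]
  set E := spow ρ (1 / 2) - u * spow σ (1 / 2) with hE
  have hsρ : star (spow ρ (1 / 2)) = spow ρ (1 / 2) := by
    simpa using star_spow hρ.nonneg (1 / 2)
  have hsσ : star (spow σ (1 / 2)) = spow σ (1 / 2) := by
    simpa using star_spow hσ.nonneg (1 / 2)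
  -- E and E* u have the same Hilbert–Schmidt size, and their half-sum and half-difference are, at
  -- exponent 1/2, the commutator and anticommutator below.
  have hEu : star E * u = spow ρ (1 / 2) * u - spow σ (1 / 2) := by
    rw [hE, star_sub, star_mul, hsρ, hsσ, sub_mul, mul_assoc, huu, mul_one]
  have hEu2 : schattenNorm 2 (star E * u) ≤ schattenNorm 2 E := by
    have := schattenNorm_mul_mul_le hρ one_le_two (star E) (V := 1) (W := u)
      ContinuousLinearMap.norm_id_le hun
    rwa [one_mul, schattenNorm_star hρ one_le_two] at this
  have hneg : schattenNorm 2 (-E) ≤ schattenNorm 2 E := by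
    have := schattenNorm_mul_mul_le hρ one_le_two E (V := -1) (W := 1)
      (by rw [norm_neg]; exact ContinuousLinearMap.norm_id_le) ContinuousLinearMap.norm_id_le
    simpa using this
  have e1 : spow ρ (1 / 2) * ((2⁻¹ : ℂ) • (u + 1)) - ((2⁻¹ : ℂ) • (u + 1)) * spow σ (1 / 2) =
      (2⁻¹ : ℂ) • (E + star E * u) := by
    rw [hEu, hE, mul_smul_comm, smul_mul_assoc, ← smul_sub, mul_add, add_mul, mul_one, one_mul]
    congr 1; abel
  have e2 : spow ρ (1 / 2) * ((2⁻¹ : ℂ) • (u - 1)) + ((2⁻¹ : ℂ) • (u - 1)) * spow σ (1 / 2) =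
      (2⁻¹ : ℂ) • (-E + star E * u) := by
    rw [hEu, hE, mul_smul_comm, smul_mul_assoc, ← smul_add, mul_sub, sub_mul, mul_one, one_mul]
    congr 1; abel
  have h1 := schattenNorm_spow_mul_sub_mul_spow_le hρ.nonneg hσ.nonneg ((2⁻¹ : ℂ) • (u + 1)) hz
  have h2 := schattenNorm_spow_mul_add_mul_spow_le hρ.nonneg hσ.nonneg ((2⁻¹ : ℂ) • (u - 1)) hz
  rw [e1] at h1
  rw [e2] at h2
  have h1' := h1.trans (mul_le_mul_of_nonneg_left
    (schattenNorm_smul_half_add_le hρ le_rfl hEu2) (norm_nonneg z))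
  have h2' := h2.trans (schattenNorm_smul_half_add_le hρ hneg hEu2)
  have e3 : spow ρ (z / 2) - u * spow σ (z / 2) =
      (spow ρ (z / 2) * ((2⁻¹ : ℂ) • (u + 1)) - ((2⁻¹ : ℂ) • (u + 1)) * spow σ (z / 2)) +
      (-1) * (spow ρ (z / 2) * ((2⁻¹ : ℂ) • (u - 1)) + ((2⁻¹ : ℂ) • (u - 1)) * spow σ (z / 2))
        * 1 := by
    simp only [mul_smul_comm, smul_mul_assoc, mul_add, add_mul, mul_sub, sub_mul, mul_one, one_mul,
      neg_mul]
    module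
  rw [e3, add_mul]
  refine (schattenNorm_add_le hρ one_le_two _ _).trans (add_le_add h1' ?_)
  rw [one_mul]
  exact (schattenNorm_mul_mul_le hρ one_le_two _ (by rw [norm_neg]; exact
    ContinuousLinearMap.norm_id_le) ContinuousLinearMap.norm_id_le).trans h2'

lemma norm_exp_sq (z : ℂ) : ‖Complex.exp (z ^ 2)‖ = Real.exp (z.re ^ 2 - z.im ^ 2) := by
  rw [Complex.norm_exp]
  congr 1
  simp [sq]

/-- Hölder continuity of the Mazur map from the Hilbert–Schmidt class to the Schatten class of
exponent `2 / θ`. -/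
lemma schattenNorm_spow_sub_le {ρ σ : H →L[ℂ] H} (hρ : IsState ρ) (hσ : IsState σ)
    {u : H →L[ℂ] H} (hu : u ∈ unitary (H →L[ℂ] H)) {θ : ℝ} (hθ : θ ∈ Set.Ioc (0 : ℝ) 1) :
    schattenNorm (2 / θ) (spow ρ (θ / 2 : ℝ) - u * spow σ (θ / 2 : ℝ)) ≤
      9 * schattenNorm 2 (CFC.sqrt ρ - u * CFC.sqrt σ) ^ θ := by
  have hθ0 := hθ.1
  have hun : ‖u‖ ≤ 1 := norm_le_one_of_mem_unitary hu
  set D := schattenNorm 2 (CFC.sqrt ρ - u * CFC.sqrt σ) with hD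
  have hD0 : 0 ≤ D := schattenNorm_nonneg _ _
  obtain ⟨U, τ, hU, hτ, h⟩ := exists_opTrace_eq_schattenNorm hρ (r := 2 / θ) (by positivity)
    (spow ρ (θ / 2 : ℝ) - u * spow σ (θ / 2 : ℝ))
  -- The factor exp(z²) absorbs the linear growth of ‖z‖ + 1 along Re z = 1; at the real point θ it
  -- is at least 1 and can be dropped.
  have hd : Differentiable ℂ fun z : ℂ => Complex.exp (z ^ 2) •
      (U * (spow ρ (z / 2) - u * spow σ (z / 2)) * spow τ (1 - z / 2)) := by
    have h1 := differentiable_spow ρ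
    have h2 := differentiable_spow σ
    have h3 := differentiable_spow τ
    have hexp : Differentiable ℂ fun z : ℂ => Complex.exp (z ^ 2) := by fun_prop
    exact hexp.smul (((differentiable_const U).mul ((h1.comp (by fun_prop)).sub
      ((differentiable_const u).mul (h2.comp (by fun_prop))))).mul (h3.comp (by fun_prop)))
  have hbd : ∀ z : ℂ, 0 ≤ z.re → z.re ≤ 1 →
      ‖U * (spow ρ (z / 2) - u * spow σ (z / 2)) * spow τ (1 - z / 2)‖ ≤ 2 := by
    intro z h0 h1
    have hz2 : 0 ≤ (z / 2).re := by simpa using (div_nonneg h0 zero_le_two)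
    have hw : 0 ≤ (1 - z / 2).re := by simp; linarith
    have hn : ‖spow ρ (z / 2) - u * spow σ (z / 2)‖ ≤ 1 + 1 * 1 :=
      norm_sub_le_of_le (hρ.norm_spow_le_one hz2) (norm_mul_le_of_le hun (hσ.norm_spow_le_one hz2))
    have := norm_mul_le_of_le (norm_mul_le_of_le hU hn) (hτ.norm_spow_le_one hw)
    linarith
  have key := norm_opTrace_le_of_strip hd (C := Real.exp 1 * 2) (a := 2) (b := 9 * D) ?_ ?_ ?_
    hθ0.le hθ.2
  · rw [opTrace_smul, norm_mul, norm_exp_sq] at key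
    have e : opTrace (U * (spow ρ ((θ : ℂ) / 2) - u * spow σ ((θ : ℂ) / 2)) *
        spow τ (1 - (θ : ℂ) / 2)) =
        schattenNorm (2 / θ) (spow ρ (θ / 2 : ℝ) - u * spow σ (θ / 2 : ℝ)) := by
      rw [← h, one_div_div]; push_cast; rfl
    rw [e, Complex.norm_real, Real.norm_of_nonneg (schattenNorm_nonneg _ _)] at key
    have h1 : 1 ≤ Real.exp ((θ : ℂ).re ^ 2 - (θ : ℂ).im ^ 2) := by
      apply Real.one_le_exp
      simp [sq_nonneg]
    refine (le_mul_of_one_le_left (schattenNorm_nonneg _ _) h1).trans (key.trans ?_)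
    rw [Real.mul_rpow (by norm_num) hD0, ← mul_assoc]
    refine mul_le_mul_of_nonneg_right ?_ (Real.rpow_nonneg hD0 _)
    calc (2 : ℝ) ^ (1 - θ) * 9 ^ θ ≤ 9 ^ (1 - θ) * 9 ^ θ := by
          refine mul_le_mul_of_nonneg_right ?_ (by positivity)
          exact Real.rpow_le_rpow (by norm_num) (by norm_num) (by linarith [hθ.2])
      _ = 9 := by rw [← Real.rpow_add (by norm_num)]; simp
  · intro z h0 h1
    rw [norm_smul, norm_exp_sq]
    refine mul_le_mul (Real.exp_le_exp.mpr ?_) (hbd z h0 h1) (norm_nonneg _) (Real.exp_pos _).le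
    nlinarith [sq_nonneg z.im]
  · intro z h0
    rw [opTrace_smul, norm_mul, norm_exp_sq]
    have h1 : Real.exp (z.re ^ 2 - z.im ^ 2) ≤ 1 := by
      apply Real.exp_le_one_iff.mpr
      rw [h0]; nlinarith [sq_nonneg z.im]
    have hw : (1 - z / 2).re = 1 := by simp [h0]
    have h2 : ‖opTrace (U * (spow ρ (z / 2) - u * spow σ (z / 2)) * spow τ (1 - z / 2))‖ ≤ 2 := by
      rw [opTrace_mul_comm]
      refine (hτ.norm_opTrace_spow_mul_le hw _).trans ?_
      have hz2 : 0 ≤ (z / 2).re := by simp [h0]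
      have hn : ‖spow ρ (z / 2) - u * spow σ (z / 2)‖ ≤ 1 + 1 * 1 :=
        norm_sub_le_of_le (hρ.norm_spow_le_one hz2)
          (norm_mul_le_of_le hun (hσ.norm_spow_le_one hz2))
      have := norm_mul_le_of_le hU hn
      linarith
    exact (mul_le_of_le_one_left (norm_nonneg _) h1).trans h2
  · intro z h1
    rw [opTrace_smul, norm_mul, norm_exp_sq]
    have hL := norm_opTrace_le_schattenNorm hτ one_le_two (spow ρ (z / 2) - u * spow σ (z / 2)) U 1
      (w := 1 - z / 2) (by simp [h1])
    rw [mul_one] at hL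
    have hL2 := hL.trans (mul_le_of_le_one_left (schattenNorm_nonneg _ _)
      (mul_le_one₀ hU (norm_nonneg _) ContinuousLinearMap.norm_id_le))
    have hL3 := hL2.trans (schattenNorm_two_spow_sub_le hρ hσ hu h1)
    have hz : ‖z‖ ≤ 1 + |z.im| := by
      have := Complex.norm_le_abs_re_add_abs_im z
      rwa [h1, abs_one] at this
    -- With y = Im z: ‖z‖ + 1 ≤ 2 + |y| ≤ 3(1 + y²) ≤ 3 exp(y²), and e < 3, whence 9.
    have hexp : Real.exp (z.re ^ 2 - z.im ^ 2) * (‖z‖ + 1) ≤ 9 := by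
      have e3 := Real.exp_one_lt_three
      have e4 : 1 + z.im ^ 2 ≤ Real.exp (z.im ^ 2) := by
        linarith [Real.add_one_le_exp (z.im ^ 2)]
      rw [h1, one_pow, Real.exp_sub, div_mul_eq_mul_div, div_le_iff₀ (Real.exp_pos _)]
      have h5 : ‖z‖ + 1 ≤ 3 * (1 + z.im ^ 2) := by
        nlinarith [sq_nonneg (|z.im| - 1), sq_abs z.im]
      nlinarith [norm_nonneg z, Real.exp_pos 1]
    calc _ ≤ Real.exp (z.re ^ 2 - z.im ^ 2) * ((‖z‖ + 1) * D) :=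
          mul_le_mul_of_nonneg_left hL3 (Real.exp_pos _).le
      _ = Real.exp (z.re ^ 2 - z.im ^ 2) * (‖z‖ + 1) * D := by ring
      _ ≤ 9 * D := mul_le_mul_of_nonneg_right hexp hD0

lemma schattenNorm_mul_mul_spow_le {ρ : H →L[ℂ] H} (hρ : IsState ρ) (F O : H →L[ℂ] H) {b r s : ℝ}
    (hb : 0 ≤ b) (hr : 1 ≤ r) (hs : 0 < s) (h : 1 / r = 1 / s + b) :
    schattenNorm r (F * O * spow ρ b) ≤ schattenNorm s F * ‖O‖ := by
  have hr0 : 0 < r := by linarith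
  have hr1 : 1 / r ≤ 1 := by rw [div_le_one hr0]; exact hr
  obtain ⟨U, τ, hU, hτ, hUτ⟩ := exists_opTrace_eq_schattenNorm hρ hr0 (F * O * spow ρ b)
  obtain ⟨W, σ, hW, hσ, hF, -⟩ := exists_schatten_polar hρ hs F
  have h3 := norm_opTrace_spow_mul₃_le hσ hρ hτ O 1 (U * W) (one_div_pos.mpr hs).le hb
    (sub_nonneg.mpr hr1) (by linarith)
  have e : (schattenNorm r (F * O * spow ρ b) : ℂ) = schattenNorm s F *
      opTrace (spow σ (1 / s : ℝ) * O * spow ρ b * 1 * spow τ (1 - 1 / r : ℝ) * (U * W)) := by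
    rw [← hUτ, opTrace_mul_comm _ (U * W)]
    conv_lhs => rw [hF]
    rw [← opTrace_smul, mul_one]
    simp only [mul_smul_comm, smul_mul_assoc, mul_assoc]
  have e' := congrArg norm e
  rw [norm_mul, Complex.norm_real, Complex.norm_real, Real.norm_of_nonneg (schattenNorm_nonneg _ _),
    Real.norm_of_nonneg (schattenNorm_nonneg _ _)] at e'
  rw [e']
  refine mul_le_mul_of_nonneg_left (h3.trans ?_) (schattenNorm_nonneg _ _)
  rw [mul_assoc]
  refine mul_le_of_le_one_right (norm_nonneg _)
    (mul_le_one₀ ContinuousLinearMap.norm_id_le (norm_nonneg _) ?_)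
  simpa using norm_mul_le_of_le hU hW

lemma correlator_le_add {ρ σ : H →L[ℂ] H} (hρ : IsState ρ) (hσ : IsState σ) (O : H →L[ℂ] H)
    {u : H →L[ℂ] H} (hu : u ∈ unitary (H →L[ℂ] H)) {p q : ℝ} (hp : p ∈ Set.Ioc (0 : ℝ) 1)
    (hq : q ∈ Set.Ioc (0 : ℝ) 1) :
    correlator p q O ρ ≤ correlator p q O σ +
      9 * ‖O‖ * (schattenNorm 2 (CFC.sqrt ρ - u * CFC.sqrt σ) ^ p +
        schattenNorm 2 (CFC.sqrt ρ - u * CFC.sqrt σ) ^ q) := by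
  have hp0 := hp.1
  have hq0 := hq.1
  have hr := one_le_two_div hp hq
  have hun : ‖u‖ ≤ 1 := norm_le_one_of_mem_unitary hu
  have hun' : ‖star u‖ ≤ 1 := by rwa [norm_star]
  rw [correlator_eq hρ.nonneg O hp0 hq0, correlator_eq hσ.nonneg O hp0 hq0]
  have hP := schattenNorm_spow_sub_le hρ hσ hu hp
  have hQ := schattenNorm_spow_sub_le hρ hσ hu hq
  set D := schattenNorm 2 (CFC.sqrt ρ - u * CFC.sqrt σ)
  -- Telescoping through u σ^(p/2) O ρ^(q/2). The second difference is written as an adjoint so that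
  -- ρ^(q/2) - u σ^(q/2) stands on the left, as in the first.
  have e : spow ρ (p / 2 : ℝ) * O * spow ρ (q / 2 : ℝ) =
      ((spow ρ (p / 2 : ℝ) - u * spow σ (p / 2 : ℝ)) * O * spow ρ (q / 2 : ℝ) +
        1 * star ((spow ρ (q / 2 : ℝ) - u * spow σ (q / 2 : ℝ)) * star O * spow σ (p / 2 : ℝ) *
          star u) * 1) +
      u * (spow σ (p / 2 : ℝ) * O * spow σ (q / 2 : ℝ)) * star u := by
    simp only [star_mul, star_sub, star_star, star_spow hρ.nonneg, star_spow hσ.nonneg, one_mul,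
      mul_one, sub_mul, mul_sub, mul_assoc]
    abel
  have h1 : schattenNorm (2 / (p + q))
      ((spow ρ (p / 2 : ℝ) - u * spow σ (p / 2 : ℝ)) * O * spow ρ (q / 2 : ℝ)) ≤
      9 * D ^ p * ‖O‖ := by
    refine (schattenNorm_mul_mul_spow_le hρ _ O (half_pos hq0).le hr (s := 2 / p) (by positivity)
      (by rw [one_div_div, one_div_div]; ring)).trans ?_
    exact mul_le_mul_of_nonneg_right hP (norm_nonneg _)
  have h2 : schattenNorm (2 / (p + q)) (1 * star ((spow ρ (q / 2 : ℝ) - u * spow σ (q / 2 : ℝ)) *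
      star O * spow σ (p / 2 : ℝ) * star u) * 1) ≤ 9 * D ^ q * ‖O‖ := by
    rw [one_mul, mul_one, schattenNorm_star hρ hr, ← one_mul (_ * star O * _)]
    refine (schattenNorm_mul_mul_le hρ hr _ ContinuousLinearMap.norm_id_le hun').trans ?_
    refine (schattenNorm_mul_mul_spow_le hσ _ (star O) (half_pos hp0).le hr (s := 2 / q)
      (by positivity) (by rw [one_div_div, one_div_div]; ring)).trans ?_
    rw [norm_star]
    exact mul_le_mul_of_nonneg_right hQ (norm_nonneg _)
  have h3 := schattenNorm_mul_mul_le hρ hr (spow σ (p / 2 : ℝ) * O * spow σ (q / 2 : ℝ)) hun hun'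
  rw [e]
  have h4 := schattenNorm_add_le hρ hr
    ((spow ρ (p / 2 : ℝ) - u * spow σ (p / 2 : ℝ)) * O * spow ρ (q / 2 : ℝ) +
        1 * star ((spow ρ (q / 2 : ℝ) - u * spow σ (q / 2 : ℝ)) * star O * spow σ (p / 2 : ℝ) *
          star u) * 1) (u * (spow σ (p / 2 : ℝ) * O * spow σ (q / 2 : ℝ)) * star u)
  have h5 := schattenNorm_add_le hρ hr
    ((spow ρ (p / 2 : ℝ) - u * spow σ (p / 2 : ℝ)) * O * spow ρ (q / 2 : ℝ))
        (1 * star ((spow ρ (q / 2 : ℝ) - u * spow σ (q / 2 : ℝ)) * star O * spow σ (p / 2 : ℝ) *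
          star u) * 1)
  linarith

lemma schattenNorm_sqrt_sub_symm {ρ : H →L[ℂ] H} (hρ : IsState ρ) (R S : H →L[ℂ] H)
    {u : H →L[ℂ] H} (hu : u ∈ unitary (H →L[ℂ] H)) :
    schattenNorm 2 (S - star u * R) ≤ schattenNorm 2 (R - u * S) := by
  have e : S - star u * R = (-star u) * (R - u * S) * 1 := by
    rw [mul_one, neg_mul, mul_sub, ← mul_assoc, Unitary.star_mul_self_of_mem hu, one_mul, neg_sub]
  rw [e]
  refine schattenNorm_mul_mul_le hρ one_le_two _ ?_ ContinuousLinearMap.norm_id_le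
  rw [norm_neg, norm_star]
  exact norm_le_one_of_mem_unitary hu

lemma abs_correlator_sub_le {ρ σ : H →L[ℂ] H} (hρ : IsState ρ) (hσ : IsState σ) (O : H →L[ℂ] H)
    {u : H →L[ℂ] H} (hu : u ∈ unitary (H →L[ℂ] H)) {p q : ℝ} (hp : p ∈ Set.Ioc (0 : ℝ) 1)
    (hq : q ∈ Set.Ioc (0 : ℝ) 1) :
    |correlator p q O ρ - correlator p q O σ| ≤
      18 * ‖O‖ * schattenNorm 2 (CFC.sqrt ρ - u * CFC.sqrt σ) ^ min p q := by
  have hm : 0 < min p q := lt_min hp.1 hq.1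
  have h1 := correlator_le_add hρ hσ O hu hp hq
  have h2 := correlator_le_add hσ hρ O (Unitary.star_mem hu) hp hq
  have hsymm := schattenNorm_sqrt_sub_symm hρ (CFC.sqrt ρ) (CFC.sqrt σ) hu
  set D := schattenNorm 2 (CFC.sqrt ρ - u * CFC.sqrt σ)
  set D' := schattenNorm 2 (CFC.sqrt σ - star u * CFC.sqrt ρ)
  have hD0 : 0 ≤ D := schattenNorm_nonneg _ _
  have hD0' : 0 ≤ D' := schattenNorm_nonneg _ _
  have hO := norm_nonneg O
  -- For D ≥ 1 the claim is trivial, both correlators lying in [0, ‖O‖]. For D ≤ 1 both powers are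
  -- at most D^min(p,q), and 9 + 9 = 18.
  rcases le_total 1 D with hD | hD
  · have b1 := correlator_le_norm hρ O hp hq
    have b2 := correlator_le_norm hσ O hp hq
    have b3 := correlator_nonneg O ρ p q
    have b4 := correlator_nonneg O σ p q
    have b5 : 1 ≤ D ^ min p q := Real.one_le_rpow hD hm.le
    rw [abs_le]
    constructor <;> nlinarith
  · have hp' : D ^ p ≤ D ^ min p q :=
      Real.rpow_le_rpow_of_exponent_ge' hD0 hD hm.le (min_le_left _ _)
    have hq' : D ^ q ≤ D ^ min p q :=
      Real.rpow_le_rpow_of_exponent_ge' hD0 hD hm.le (min_le_right _ _)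
    have hp'' : D' ^ p ≤ D ^ p := Real.rpow_le_rpow hD0' hsymm hp.1.le
    have hq'' : D' ^ q ≤ D ^ q := Real.rpow_le_rpow hD0' hsymm hq.1.le
    have k1 : 9 * ‖O‖ * (D ^ p + D ^ q) ≤ 9 * ‖O‖ * (D ^ min p q + D ^ min p q) := by gcongr
    have k2 : 9 * ‖O‖ * (D' ^ p + D' ^ q) ≤ 9 * ‖O‖ * (D ^ p + D ^ q) := by gcongr
    rw [abs_le]
    constructor <;> linarith

lemma abs_correlator_sub_le_buresDist {ρ σ : H →L[ℂ] H} (hρ : IsState ρ) (hσ : IsState σ)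
    (O : H →L[ℂ] H) {p q : ℝ} (hp : p ∈ Set.Ioc (0 : ℝ) 1) (hq : q ∈ Set.Ioc (0 : ℝ) 1) :
    |correlator p q O ρ - correlator p q O σ| ≤ 18 * ‖O‖ * buresDist ρ σ ^ min p q := by
  have hm : 0 < min p q := lt_min hp.1 hq.1
  have hall := fun u : unitary (H →L[ℂ] H) => abs_correlator_sub_le hρ hσ O u.2 hp hq
  have hB0 : 0 ≤ buresDist ρ σ := Real.iInf_nonneg fun u => schattenNorm_nonneg _ _
  rcases (norm_nonneg O).eq_or_lt with hO | hO
  · have := hall 1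
    simpa [← hO] using this
  have hK : 0 < 18 * ‖O‖ := by positivity
  set δ := |correlator p q O ρ - correlator p q O σ|
  have hδ : 0 ≤ δ / (18 * ‖O‖) := div_nonneg (abs_nonneg _) hK.le
  -- Solving for the Hilbert–Schmidt distance lets the bound pass to the infimum over u, without
  -- attainment.
  have h : (δ / (18 * ‖O‖)) ^ (min p q)⁻¹ ≤ buresDist ρ σ := by
    refine le_ciInf fun u => ?_
    rw [Real.rpow_inv_le_iff_of_pos hδ (schattenNorm_nonneg _ _) hm, div_le_iff₀' hK]
    exact hall u
  rw [Real.rpow_inv_le_iff_of_pos hδ hB0 hm, div_le_iff₀' hK] at h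
  exact h

end Continuity

/-! ### Tensor products. -/

section Multiplicativity

variable {H₁ H₂ : Type*} [NormedAddCommGroup H₁] [InnerProductSpace ℂ H₁] [FiniteDimensional ℂ H₁]
  [NormedAddCommGroup H₂] [InnerProductSpace ℂ H₂] [FiniteDimensional ℂ H₂]

lemma opTensor_eq_mapL (A : H₁ →L[ℂ] H₁) (B : H₂ →L[ℂ] H₂) :
    opTensor A B = TensorProduct.mapL A B := by
  ext x
  simp [opTensor]

lemma opTensor_mul (A C : H₁ →L[ℂ] H₁) (B D : H₂ →L[ℂ] H₂) :
    opTensor A B * opTensor C D = opTensor (A * C) (B * D) := by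
  simp only [opTensor_eq_mapL, TensorProduct.mapL_mul]

lemma star_opTensor (A : H₁ →L[ℂ] H₁) (B : H₂ →L[ℂ] H₂) :
    star (opTensor A B) = opTensor (star A) (star B) := by
  simp only [opTensor_eq_mapL, ContinuousLinearMap.star_eq_adjoint, TensorProduct.adjoint_mapL]

lemma opTensor_tmul (A : H₁ →L[ℂ] H₁) (B : H₂ →L[ℂ] H₂) (x : H₁) (y : H₂) :
    opTensor A B (x ⊗ₜ y) = A x ⊗ₜ B y := by
  simp [opTensor]

lemma opTrace_opTensor (A : H₁ →L[ℂ] H₁) (B : H₂ →L[ℂ] H₂) :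
    opTrace (opTensor A B) = opTrace A * opTrace B :=
  LinearMap.trace_tensorProduct' (A : H₁ →ₗ[ℂ] H₁) (B : H₂ →ₗ[ℂ] H₂)

/-- Positive square roots are unique, so any positive S with S² = T*T is |T|; used with S = |A| ⊗
|B|. -/
lemma schattenNorm_eq_of_mul_self_eq {H : Type*} [NormedAddCommGroup H] [InnerProductSpace ℂ H]
    [FiniteDimensional ℂ H] {S T : H →L[ℂ] H} (hS : 0 ≤ S) (h : S * S = star T * T) {r : ℝ}
    (hr : 0 < r) : schattenNorm r T = (opTrace (spow S r)).re ^ (1 / r) := by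
  rw [schattenNorm, abs_rpow_eq_spow T hr, CFC.abs, CFC.sqrt_unique h hS]

lemma opTensor_nonneg {A : H₁ →L[ℂ] H₁} {B : H₂ →L[ℂ] H₂} (hA : 0 ≤ A) (hB : 0 ≤ B) :
    0 ≤ opTensor A B := by
  obtain ⟨a, rfl⟩ := (CStarAlgebra.nonneg_iff_eq_star_mul_self (a := A)).mp hA
  obtain ⟨b, rfl⟩ := (CStarAlgebra.nonneg_iff_eq_star_mul_self (a := B)).mp hB
  rw [← opTensor_mul, ← star_opTensor]
  exact star_mul_self_nonneg (opTensor a b)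

lemma powFun_mul {x y : ℝ} (hx : 0 ≤ x) (hy : 0 ≤ y) (z : ℂ) :
    powFun z ((x : ℂ) * y) = powFun z x * powFun z y := by
  by_cases h1 : x = 0
  · simp [powFun, h1]
  by_cases h2 : y = 0
  · simp [powFun, h2]
  simp [powFun, h1, h2, Complex.mul_cpow_ofReal_nonneg hx hy]

/-- Both sides act diagonally on the product of two eigenbases, and (l m)^z = l^z m^z for
nonnegative l, m. -/
lemma spow_opTensor {A : H₁ →L[ℂ] H₁} {B : H₂ →L[ℂ] H₂} (hA : 0 ≤ A) (hB : 0 ≤ B) (z : ℂ) :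
    spow (opTensor A B) z = opTensor (spow A z) (spow B z) := by
  obtain ⟨b, l, hl, hb⟩ := exists_eigenbasis hA
  obtain ⟨c, m, hm, hc⟩ := exists_eigenbasis hB
  refine ContinuousLinearMap.coe_injective ((b.tensorProduct c).toBasis.ext fun ij => ?_)
  have h : opTensor A B (b ij.1 ⊗ₜ[ℂ] c ij.2) =
      ((l ij.1 : ℂ) * (m ij.2 : ℂ)) • (b ij.1 ⊗ₜ[ℂ] c ij.2) := by
    rw [opTensor_tmul, hb, hc, TensorProduct.smul_tmul_smul]
  have := spow_apply_of_eigenvector (opTensor_nonneg hA hB) z h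
  simp only [OrthonormalBasis.coe_toBasis, OrthonormalBasis.tensorProduct_apply',
    ContinuousLinearMap.coe_coe, this, opTensor_tmul, spow_apply_of_eigenvector hA z (hb _),
    spow_apply_of_eigenvector hB z (hc _), TensorProduct.smul_tmul_smul, powFun_mul (hl _) (hm _)]

lemma schattenNorm_opTensor {r : ℝ} (hr : 0 < r) (A : H₁ →L[ℂ] H₁) (B : H₂ →L[ℂ] H₂) :
    schattenNorm r (opTensor A B) = schattenNorm r A * schattenNorm r B := by
  have hA := CFC.abs_nonneg A
  have hB := CFC.abs_nonneg B
  obtain ⟨a0, ha⟩ := opTrace_of_nonneg (spow_nonneg hA r)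
  obtain ⟨b0, hb⟩ := opTrace_of_nonneg (spow_nonneg hB r)
  have h : opTensor (CFC.abs A) (CFC.abs B) * opTensor (CFC.abs A) (CFC.abs B) =
      star (opTensor A B) * opTensor A B := by
    rw [opTensor_mul, CFC.abs_mul_abs, CFC.abs_mul_abs, star_opTensor, opTensor_mul]
  rw [schattenNorm_eq_of_mul_self_eq (opTensor_nonneg hA hB) h hr, schattenNorm, schattenNorm,
    abs_rpow_eq_spow _ hr, abs_rpow_eq_spow _ hr, spow_opTensor hA hB, opTrace_opTensor, ← ha, ← hb,
    ← Complex.ofReal_mul, Complex.ofReal_re, Complex.ofReal_re, Complex.ofReal_re,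
    Real.mul_rpow a0 b0]

lemma correlator_opTensor {ρ₁ : H₁ →L[ℂ] H₁} {ρ₂ : H₂ →L[ℂ] H₂} (h₁ : 0 ≤ ρ₁) (h₂ : 0 ≤ ρ₂)
    (O₁ : H₁ →L[ℂ] H₁) (O₂ : H₂ →L[ℂ] H₂) {p q : ℝ} (hp : 0 < p) (hq : 0 < q) :
    correlator p q (opTensor O₁ O₂) (opTensor ρ₁ ρ₂) =
      correlator p q O₁ ρ₁ * correlator p q O₂ ρ₂ := by
  rw [correlator_eq (opTensor_nonneg h₁ h₂) _ hp hq, correlator_eq h₁ _ hp hq,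
    correlator_eq h₂ _ hp hq, spow_opTensor h₁ h₂, spow_opTensor h₁ h₂, opTensor_mul, opTensor_mul,
    schattenNorm_opTensor (by positivity)]

end Multiplicativity

end

end NonlinearCorrelator

theorem mainTheorem10 :
    (∀ (H : Type*) [NormedAddCommGroup H] [InnerProductSpace ℂ H] [FiniteDimensional ℂ H]
        (ρ O : H →L[ℂ] H), NonlinearCorrelator.IsState ρ →
      -- positivity, and when the correlator vanishes
      (∀ p ∈ Set.Ioc (0 : ℝ) 1, ∀ q ∈ Set.Ioc (0 : ℝ) 1,
        0 ≤ NonlinearCorrelator.correlator p q O ρ ∧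
        (NonlinearCorrelator.correlator p q O ρ = 0 ↔
          (NonlinearCorrelator.supp ρ).map (O : H →ₗ[ℂ] H) ≤ (NonlinearCorrelator.supp ρ)ᗮ)) ∧
      -- monotonicity in each parameter
      (∀ q ∈ Set.Ioc (0 : ℝ) 1,
        AntitoneOn (fun p => NonlinearCorrelator.correlator p q O ρ) (Set.Ioc (0 : ℝ) 1)) ∧
      (∀ p ∈ Set.Ioc (0 : ℝ) 1,
        AntitoneOn (fun q => NonlinearCorrelator.correlator p q O ρ) (Set.Ioc (0 : ℝ) 1)) ∧
      -- range
      (∀ p ∈ Set.Ioc (0 : ℝ) 1, ∀ q ∈ Set.Ioc (0 : ℝ) 1,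
        ‖NonlinearCorrelator.opTrace (ρ * O)‖ ≤ NonlinearCorrelator.correlator p q O ρ ∧
        NonlinearCorrelator.correlator p q O ρ ≤ ‖O‖) ∧
      -- symmetry
      (∀ p ∈ Set.Ioc (0 : ℝ) 1, ∀ q ∈ Set.Ioc (0 : ℝ) 1,
        NonlinearCorrelator.correlator p q O ρ =
          NonlinearCorrelator.correlator q p (ContinuousLinearMap.adjoint O) ρ) ∧
      -- joint log-convexity
      (∀ p₀ ∈ Set.Ioc (0 : ℝ) 1, ∀ q₀ ∈ Set.Ioc (0 : ℝ) 1,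
        ∀ p₁ ∈ Set.Ioc (0 : ℝ) 1, ∀ q₁ ∈ Set.Ioc (0 : ℝ) 1, ∀ θ ∈ Set.Icc (0 : ℝ) 1,
        NonlinearCorrelator.correlator ((1 - θ) * p₀ + θ * p₁) ((1 - θ) * q₀ + θ * q₁) O ρ ≤
          NonlinearCorrelator.correlator p₀ q₀ O ρ ^ (1 - θ) *
            NonlinearCorrelator.correlator p₁ q₁ O ρ ^ θ) ∧
      ((∀ p ∈ Set.Ioc (0 : ℝ) 1, ∀ q ∈ Set.Ioc (0 : ℝ) 1,
          NonlinearCorrelator.correlator p q O ρ ≠ 0) →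
        ConvexOn ℝ (Set.Ioc (0 : ℝ) 1 ×ˢ Set.Ioc (0 : ℝ) 1)
          (fun x : ℝ × ℝ => Real.log (NonlinearCorrelator.correlator x.1 x.2 O ρ)))) ∧
    -- multiplicativity
    (∀ (H₁ H₂ : Type*) [NormedAddCommGroup H₁] [InnerProductSpace ℂ H₁] [FiniteDimensional ℂ H₁]
        [NormedAddCommGroup H₂] [InnerProductSpace ℂ H₂] [FiniteDimensional ℂ H₂]
        (ρ₁ O₁ : H₁ →L[ℂ] H₁) (ρ₂ O₂ : H₂ →L[ℂ] H₂),
      NonlinearCorrelator.IsState ρ₁ → NonlinearCorrelator.IsState ρ₂ →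
      ∀ p ∈ Set.Ioc (0 : ℝ) 1, ∀ q ∈ Set.Ioc (0 : ℝ) 1,
        NonlinearCorrelator.correlator p q
            (NonlinearCorrelator.opTensor O₁ O₂) (NonlinearCorrelator.opTensor ρ₁ ρ₂) =
          NonlinearCorrelator.correlator p q O₁ ρ₁ * NonlinearCorrelator.correlator p q O₂ ρ₂) ∧
    -- continuity, with one constant for all spaces, operators, states and parameters
    (∃ K : ℝ, 0 < K ∧
      ∀ (H : Type*) [NormedAddCommGroup H] [InnerProductSpace ℂ H] [FiniteDimensional ℂ H]
        (ρ σ O : H →L[ℂ] H), NonlinearCorrelator.IsState ρ → NonlinearCorrelator.IsState σ →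
      ∀ p ∈ Set.Ioc (0 : ℝ) 1, ∀ q ∈ Set.Ioc (0 : ℝ) 1,
        |NonlinearCorrelator.correlator p q O ρ - NonlinearCorrelator.correlator p q O σ| ≤
          K * ‖O‖ * NonlinearCorrelator.buresDist ρ σ ^ min p q) := by
  refine ⟨fun H _ _ _ ρ O hρ => ⟨fun p hp q hq => ⟨?_, ?_⟩, fun q hq => ?_, fun p hp => ?_,
    fun p hp q hq => ⟨?_, ?_⟩, fun p hp q hq => ?_, fun p₀ hp₀ q₀ hq₀ p₁ hp₁ q₁ hq₁ θ hθ => ?_,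
    fun h => ?_⟩, fun H₁ H₂ _ _ _ _ _ _ ρ₁ O₁ ρ₂ O₂ h₁ h₂ p hp q hq => ?_,
    18, by norm_num, fun H _ _ _ ρ σ O hρ hσ p hp q hq => ?_⟩
  · exact NonlinearCorrelator.correlator_nonneg O ρ p q
  · exact NonlinearCorrelator.correlator_eq_zero_iff hρ O hp.1 hq.1
  · exact NonlinearCorrelator.correlator_antitone_left hρ O hq
  · exact NonlinearCorrelator.correlator_antitone_right hρ O hp
  · exact NonlinearCorrelator.norm_opTrace_mul_le_correlator hρ O hp hq
  · exact NonlinearCorrelator.correlator_le_norm hρ O hp hq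
  · exact NonlinearCorrelator.correlator_adjoint hρ O hp hq
  · exact NonlinearCorrelator.correlator_log_convex hρ O hp₀ hq₀ hp₁ hq₁ hθ
  · exact NonlinearCorrelator.convexOn_log_correlator hρ O h
  · exact NonlinearCorrelator.correlator_opTensor h₁.nonneg h₂.nonneg O₁ O₂ hp.1 hq.1
  · exact NonlinearCorrelator.abs_correlator_sub_le_buresDist hρ hσ O hp hq
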